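/- Let $d\ge 2$, $l\ge 1$, $n=3d$. A rational plane tropical curve $C=(\Gamma,x_1,\dots,x_n,h)$ of degree $d$ with $n$ markings consists of a metric tree $\Gamma$ with bounded and unbounded edges, all vertices having valence at least $3$, of distinct unbounded edges $x_1,\dots,x_n$, and of a continuous map $h:\Gamma\to\mathbb R^2$ which is affine with an integral direction vector on every edge, is balanced at every vertex, contracts every $x_i$ to a point, and has on the other unbounded edges the directions $(-1,0),(0,-1),(1,1)$, each exactly $d$ times. Let $\mathcal L^l\subset\mathbb R^2$ be a tropical plane curve of degree $l$, i.e. the set of points where $\max_{i+j\le l}(a_{ij}+ix+jy)$ is attained at least twice, with real coefficients $a_{ij}$. Let $\mathcal M_4$ be the space of abstract $4$-marked rational tropical curves; a curve of type (A) with length $t>0$ has one bounded edge, of length $t$, which separates $x_1,x_2$ from $x_3,x_4$. On the space of curves $C$ as above with $h(x_1),h(x_2)\in\mathcal L^l$, consider the map $$\tilde\pi=ev_3\times\dots\times ev_n\times\delta,\qquad \tilde\pi(C)=(h(x_3),\dots,h(x_n),\delta(C))\in\mathbb R^{2n-4}\times\mathcal M_4,$$ where $\delta$ forgets $h$ and all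 unbounded edges except $x_1,\dots,x_4$. Call $C$ general if $\Gamma$ is trivalent and $h(x_1),h(x_2)$ lie in the relative interiors of edges of $\mathcal L^l$. (If $P$ is in $\tilde\pi$-general position, all curves in $\tilde\pi^{-1}(P)$ are general by definition.) For a general $C$ the multiplicity $\operatorname{mult}_C(\tilde\pi)$ is the absolute value of the determinant of the square matrix of size $2n-1$, in the position of a root vertex and the lengths of the bounded edges, whose rows are the coordinates of $h(x_3),\dots,h(x_n)$, the length of the bounded edge of $\delta(C)$, and, for $i=1,2$, the evaluation at $x_i$ in the direction of the integral normal vector of the edge of $\mathcal L^l$ through $h(x_i)$, of lattice length the weight of this edge. Let $p_3,\dots,p_n\in\mathbb R^2$. There is a real number $R$, which may depend on $d$, $\mathcal L^l$ and $p_3,\dots,p_n$, such that the following holds for every $z\in\mathcal M_4$ of type (A) with length $t>R$, with $P=(p_3,\dots,p_n,z)$. Every general curve $C\in\tilde\pi^{-1}(P)$ with $\operatorname{mult}_C(\tilde\pi)\ne 0$ satisfies at least one of the following. (a) The markings $x_1$ and $x_2$ are adjacent to the same vertex. (b) $C$ decomposes uniquely into two components $C_1$ and $C_2$: it has exactly one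 contracted bounded edge $E$, and splitting $C$ at $E$ (so that $E$ becomes a contracted unbounded edge on both sides) gives plane tropical curves $C_1$, $C_2$ of degrees $d_1,d_2\ge1$ with $d_1+d_2=d$, such that $x_1,x_2$ are on $C_1$, $x_3,x_4$ are on $C_2$, and exactly $3d_1-1$ of the markings $x_5,\dots,x_{3d}$ are on $C_1$. -/

import Mathlib

open scoped BigOperators

namespace PlaneTropical

noncomputable section

open Classical in
/-- A plane tropical curve of genus zero whose marked (contracted) unbounded edges are indexed by `I`.

The underlying metric graph is given by its vertices, its bounded edges (the edges of a tree on the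
vertices, with lengths), its marked unbounded edges (attached at `mark i`) and its remaining unbounded
edges (attached at `endAt u`).  The map to the plane is affine on each edge with integral slope: it is
given by the images `pos v` of the vertices, by the direction vectors `dir v w` of the flags at `v` in
the bounded edge from `v` to `w`, and by the direction vectors of the unmarked unbounded edges; marked
edges are contracted, so that they have direction `0`.  The values of `len` and `dir` matter on edges
only. -/
structure PlaneTropicalCurve (I : Type) [Fintype I] where
  /-- vertices -/
  V : Type
  [fintypeV : Fintype V]
  /-- unmarked unbounded edges -/
  U : Type
  [fintypeU : Fintype U]
  /-- bounded edges -/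
  graph : SimpleGraph V
  isTree : graph.IsTree
  len : Sym2 V → ℝ
  len_pos : ∀ e ∈ graph.edgeSet, 0 < len e
  mark : I → V
  endAt : U → V
  endDir : U → Fin 2 → ℤ
  pos : V → Fin 2 → ℝ
  dir : V → V → Fin 2 → ℤ
  pos_sub : ∀ v w, graph.Adj v w → ∀ j, pos w j - pos v j = len s(v, w) * (dir v w j : ℝ)
  balanced : ∀ v, (∑ w, if graph.Adj v w then dir v w else 0)
    + (∑ u, if endAt u = v then endDir u else 0) = 0
  three_le_valence : ∀ v, 3 ≤ (∑ w, if graph.Adj v w then 1 else 0)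
    + (∑ u, if endAt u = v then 1 else 0) + (∑ i, if mark i = v then 1 else 0)

attribute [instance] PlaneTropicalCurve.fintypeV PlaneTropicalCurve.fintypeU

/-- The degree of a plane curve of degree `d`: each of `(-1,0)`, `(0,-1)`, `(1,1)` taken `d` times. -/
def standardDegree (d : ℕ) : Multiset (Fin 2 → ℤ) :=
  Multiset.replicate d ![-1, 0] + Multiset.replicate d ![0, -1] + Multiset.replicate d ![1, 1]

namespace PlaneTropicalCurve

variable {I : Type} [Fintype I] (C : PlaneTropicalCurve I)

/-- The multiset of directions of the unmarked unbounded edges. -/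
def degree : Multiset (Fin 2 → ℤ) := Finset.univ.val.map C.endDir

/-- The evaluation at the `i`-th marking. -/
def ev (i : I) : Fin 2 → ℝ := C.pos (C.mark i)

open Classical in
/-- The number of flags at a vertex. -/
def valence (v : C.V) : ℕ := (∑ w, if C.graph.Adj v w then 1 else 0)
  + (∑ u, if C.endAt u = v then 1 else 0) + (∑ i, if C.mark i = v then 1 else 0)

/-- The combinatorial type has codimension `∑ v, (valence v - 3) = 0`. -/
def IsTrivalent : Prop := ∀ v, C.valence v = 3

/-! ### Splitting a curve at a contracted bounded edge -/

/-- A contracted bounded edge, together with an orientation (from `fst` to `snd`). -/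
structure ContractedEdge where
  fst : C.V
  snd : C.V
  adj : C.graph.Adj fst snd
  dir_eq_zero : C.dir fst snd = 0

variable {C}

/-- The vertices on the side of `E.fst` after the removal of the edge `E`. -/
def ContractedEdge.side (E : C.ContractedEdge) : Set C.V :=
  {v | (C.graph.deleteEdges {s(E.fst, E.snd)}).Reachable E.fst v}

/-- The same edge with the opposite orientation. -/
def ContractedEdge.symm (E : C.ContractedEdge) : C.ContractedEdge where
  fst := E.snd
  snd := E.fst
  adj := E.adj.symm
  dir_eq_zero := by
    funext j
    have h1 := C.pos_sub _ _ E.adj j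
    have h2 := C.pos_sub _ _ E.adj.symm j
    have h3 : (0 : ℝ) < C.len s(E.snd, E.fst) := C.len_pos _ E.adj.symm
    rw [E.dir_eq_zero] at h1
    simp only [Pi.zero_apply, Int.cast_zero, mul_zero] at h1
    have h4 : C.len s(E.snd, E.fst) * (C.dir E.snd E.fst j : ℝ) = 0 := by linarith
    rcases mul_eq_zero.mp h4 with h | h
    · exact absurd h h3.ne'
    · exact_mod_cast h

theorem ContractedEdge.fst_mem (E : C.ContractedEdge) : E.fst ∈ E.side :=
  SimpleGraph.Reachable.refl _

theorem ContractedEdge.snd_notMem (E : C.ContractedEdge) : E.snd ∉ E.side := by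
  have h := SimpleGraph.isAcyclic_iff_forall_adj_isBridge.mp C.isTree.isAcyclic E.adj
  exact (SimpleGraph.isBridge_iff.mp h)

theorem ContractedEdge.eq_of_adj (E : C.ContractedEdge) {v w : C.V} (hv : v ∈ E.side)
    (hw : w ∉ E.side) (h : C.graph.Adj v w) : v = E.fst ∧ w = E.snd := by
  by_cases he : s(v, w) = s(E.fst, E.snd)
  · rcases Sym2.eq_iff.mp he with h1 | h1
    · exact h1
    · exact absurd (h1.2 ▸ E.fst_mem) hw
  · exfalso
    apply hw
    refine SimpleGraph.Reachable.trans (show _ from hv) (SimpleGraph.Adj.reachable ?_)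
    rw [SimpleGraph.deleteEdges_adj]
    exact ⟨h, he⟩

theorem ContractedEdge.isTree_induce (E : C.ContractedEdge) :
    (C.graph.induce E.side).IsTree := by
  refine ⟨?_, C.isTree.isAcyclic.induce _⟩
  rw [SimpleGraph.connected_iff_exists_forall_reachable]
  refine ⟨⟨E.fst, E.fst_mem⟩, ?_⟩
  rintro ⟨w, hw⟩
  have key : ∀ (a b : C.V) (p : (C.graph.deleteEdges {s(E.fst, E.snd)}).Walk a b)
      (ha : a ∈ E.side) (hb : b ∈ E.side),
      (C.graph.induce E.side).Reachable ⟨a, ha⟩ ⟨b, hb⟩ := by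
    intro a b p
    induction p with
    | nil => intro _ _; exact SimpleGraph.Reachable.refl _
    | @cons a c b hac _ ih =>
      intro ha hb
      have hc : c ∈ E.side := SimpleGraph.Reachable.trans (show _ from ha) hac.reachable
      refine SimpleGraph.Reachable.trans (SimpleGraph.Adj.reachable ?_) (ih hc hb)
      exact (SimpleGraph.deleteEdges_adj.mp hac).1
  obtain ⟨p⟩ := (show (C.graph.deleteEdges {s(E.fst, E.snd)}).Reachable E.fst w from hw)
  exact key _ _ p E.fst_mem hw

open Classical in
/-- The markings on the component of `E.fst`: the markings of `C` on this side, and one more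
marking `none` for the edge `E` at which `C` is split. -/
abbrev ContractedEdge.Marking (E : C.ContractedEdge) : Type := Option {i : I // C.mark i ∈ E.side}

open Classical in
/-- The component on the side of `E.fst` of the curve `C` split at the contracted bounded edge `E`:
the edge `E` is made into a contracted unbounded edge, which is a new marking. -/
def ContractedEdge.component (E : C.ContractedEdge) : PlaneTropicalCurve E.Marking where
  V := E.side
  U := {u : C.U // C.endAt u ∈ E.side}
  graph := C.graph.induce E.side
  isTree := E.isTree_induce
  len := fun e => C.len (e.map Subtype.val)
  len_pos := by
    intro e
    induction e with
    | h v w => exact fun h => C.len_pos s(v.1, w.1) h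
  mark := fun o => o.elim ⟨E.fst, E.fst_mem⟩ (fun i => ⟨C.mark i.1, i.2⟩)
  endAt := fun u => ⟨C.endAt u.1, u.2⟩
  endDir := fun u => C.endDir u.1
  pos := fun v => C.pos v.1
  dir := fun v w => C.dir v.1 w.1
  pos_sub := fun v w h j => C.pos_sub v.1 w.1 h j
  balanced := by
    rintro ⟨v, hv⟩
    have h := C.balanced v
    rw [← Fintype.sum_subtype_add_sum_subtype (fun w => w ∈ E.side),
      ← Fintype.sum_subtype_add_sum_subtype (fun u => C.endAt u ∈ E.side)] at h
    have h1 : (∑ w : {w // w ∉ E.side}, if C.graph.Adj v w.1 then C.dir v w.1 else 0) = 0 := by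
      refine Finset.sum_eq_zero fun w _ => ?_
      split_ifs with hvw
      · obtain ⟨rfl, h2⟩ := E.eq_of_adj hv w.2 hvw
        rw [h2, E.dir_eq_zero]
      · rfl
    have h2 : (∑ u : {u // C.endAt u ∉ E.side}, if C.endAt u.1 = v then C.endDir u.1 else 0) = 0 := by
      refine Finset.sum_eq_zero fun u _ => ?_
      rw [if_neg]
      rintro rfl
      exact u.2 hv
    rw [h1, h2, add_zero, add_zero] at h
    simpa [Subtype.ext_iff] using h
  three_le_valence := by
    rintro ⟨v, hv⟩
    have h := C.three_le_valence v
    rw [← Fintype.sum_subtype_add_sum_subtype (fun w => w ∈ E.side),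
      ← Fintype.sum_subtype_add_sum_subtype (fun u => C.endAt u ∈ E.side),
      ← Fintype.sum_subtype_add_sum_subtype (fun i => C.mark i ∈ E.side)] at h
    have h1 : (∑ w : {w // w ∉ E.side}, if C.graph.Adj v w.1 then 1 else 0)
        ≤ if E.fst = v then 1 else 0 := by
      by_cases hE : E.fst = v
      · rw [if_pos hE]
        have : ∀ w : {w // w ∉ E.side}, (if C.graph.Adj v w.1 then 1 else 0)
            ≤ if w = ⟨E.snd, E.snd_notMem⟩ then 1 else 0 := by
          intro w
          by_cases hvw : C.graph.Adj v w.1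
          · have := (E.eq_of_adj hv w.2 hvw).2
            rw [if_pos hvw, if_pos (Subtype.ext this)]
          · rw [if_neg hvw]; exact Nat.zero_le _
        refine (Finset.sum_le_sum fun w _ => this w).trans ?_
        simp
      · rw [if_neg hE]
        refine (Finset.sum_eq_zero fun w _ => ?_).le
        rw [if_neg]
        intro hvw
        exact hE (E.eq_of_adj hv w.2 hvw).1.symm
    have h2 : (∑ u : {u // C.endAt u ∉ E.side}, if C.endAt u.1 = v then 1 else 0) = 0 := by
      refine Finset.sum_eq_zero fun u _ => ?_
      rw [if_neg]
      rintro rfl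
      exact u.2 hv
    have h3 : (∑ i : {i // C.mark i ∉ E.side}, if C.mark i.1 = v then 1 else 0) = 0 := by
      refine Finset.sum_eq_zero fun i _ => ?_
      rw [if_neg]
      rintro rfl
      exact i.2 hv
    rw [h2, h3, add_zero, add_zero] at h
    simp only [Fintype.sum_option, Option.elim, Subtype.mk.injEq, SimpleGraph.comap_adj,
      Function.Embedding.subtype_apply]
    refine h.trans ?_
    generalize (∑ w : {w // w ∉ E.side}, if C.graph.Adj v w.1 then 1 else 0) = y at h1
    generalize hx : (if E.fst = v then 1 else 0) = x at h1 ⊢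
    have e1 : (∑ w : {w // w ∈ E.side}, if C.graph.Adj v w.1 then 1 else 0)
      = ∑ w : E.side, if C.graph.Adj v w.1 then 1 else 0 := rfl
    omega

variable (C)

/-! ### The forgetful map to the moduli space of abstract four-marked curves -/

/-- The removal of the edge `e` separates the markings `i`, `j` from the markings `k`, `m`. -/
def Separates (e : Sym2 C.V) (i j k m : I) : Prop :=
  (C.graph.deleteEdges {e}).Reachable (C.mark i) (C.mark j) ∧
  (C.graph.deleteEdges {e}).Reachable (C.mark k) (C.mark m) ∧
  ¬ (C.graph.deleteEdges {e}).Reachable (C.mark i) (C.mark k)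

open Classical in
/-- The total length of the bounded edges that separate `i`, `j` from `k`, `m`: the length of the
path which the subtree spanned by the unbounded edges `i`, `j`, `k`, `m` has between `{i, j}` and
`{k, m}`. -/
def separatingLength (i j k m : I) : ℝ :=
  ∑ e : C.graph.edgeSet, if C.Separates e i j k m then C.len e else 0

end PlaneTropicalCurve

/-- The moduli space of abstract tropical curves with four markings `x₁, x₂, x₃, x₄`: in types
(A), (B), (C) there is one bounded edge, of length `t > 0`, which separates `x₁, x₂` from `x₃, x₄`,
respectively `x₁, x₃` from `x₂, x₄`, respectively `x₁, x₄` from `x₂, x₃`; in type (D) there is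
a single vertex of valence four. -/
inductive M4 : Type
  | A (t : ℝ) (ht : 0 < t)
  | B (t : ℝ) (ht : 0 < t)
  | C (t : ℝ) (ht : 0 < t)
  | D

open Classical in
/-- The forgetful map: keep the subtree spanned by the four markings `x 0, …, x 3`, straighten its
two-valent vertices, and forget the map to the plane. -/
def PlaneTropicalCurve.forget {I : Type} [Fintype I] (C : PlaneTropicalCurve I) (x : Fin 4 → I) :
    M4 :=
  if hA : 0 < C.separatingLength (x 0) (x 1) (x 2) (x 3) then M4.A _ hA
  else if hB : 0 < C.separatingLength (x 0) (x 2) (x 1) (x 3) then M4.B _ hB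
  else if hC : 0 < C.separatingLength (x 0) (x 3) (x 1) (x 2) then M4.C _ hC
  else M4.D

/-! ### Tropical curves of degree `l` in the plane, as corner loci -/

/-- The exponents of the monomials of degree at most `l`. -/
def exponents (l : ℕ) : Finset (ℕ × ℕ) :=
  (Finset.range (l + 1) ×ˢ Finset.range (l + 1)).filter fun m => m.1 + m.2 ≤ l

/-- The value at `q` of the tropical monomial with exponent `m` and coefficient `a m`. -/
def monomialValue (a : ℕ × ℕ → ℝ) (q : Fin 2 → ℝ) (m : ℕ × ℕ) : ℝ :=
  a m + m.1 * q 0 + m.2 * q 1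

open Classical in
/-- The exponents at which the tropical polynomial `max_m (a m + m.1 * q 0 + m.2 * q 1)`, over all
monomials of degree at most `l`, attains its maximum. -/
def maximizers (l : ℕ) (a : ℕ × ℕ → ℝ) (q : Fin 2 → ℝ) : Finset (ℕ × ℕ) :=
  (exponents l).filter fun m => ∀ m' ∈ exponents l, monomialValue a q m' ≤ monomialValue a q m

/-- The tropical plane curve of degree `l` given by the coefficients `a`: the points at which the
maximum is attained at least twice. -/
def tropicalPlaneCurve (l : ℕ) (a : ℕ × ℕ → ℝ) : Set (Fin 2 → ℝ) :=
  {q | 2 ≤ (maximizers l a q).card}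

/-- `m - m'` as an integral vector. -/
def exponentDiff (m m' : ℕ × ℕ) : Fin 2 → ℤ := ![(m.1 : ℤ) - m'.1, (m.2 : ℤ) - m'.2]

/-- The points in the relative interior of an edge of the curve: the monomials which attain the
maximum have exponents on one line. -/
def IsEdgePoint (l : ℕ) (a : ℕ × ℕ → ℝ) (q : Fin 2 → ℝ) : Prop :=
  q ∈ tropicalPlaneCurve l a ∧
    ∀ m ∈ maximizers l a q, ∀ m' ∈ maximizers l a q, ∀ m'' ∈ maximizers l a q,
      exponentDiff m' m 0 * exponentDiff m'' m 1 = exponentDiff m' m 1 * exponentDiff m'' m 0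

theorem maximizers_nonempty (l : ℕ) (a : ℕ × ℕ → ℝ) (q : Fin 2 → ℝ) :
    (maximizers l a q).Nonempty := by
  have h : (exponents l).Nonempty := ⟨(0, 0), by simp [exponents]⟩
  obtain ⟨m, hm, hmax⟩ := Finset.exists_max_image (exponents l) (monomialValue a q) h
  exact ⟨m, by simp only [maximizers, Finset.mem_filter]; exact ⟨hm, hmax⟩⟩

theorem exists_longest (l : ℕ) (a : ℕ × ℕ → ℝ) (q : Fin 2 → ℝ) :
    ∃ ν : Fin 2 → ℤ, (∃ m ∈ maximizers l a q, ∃ m' ∈ maximizers l a q, ν = exponentDiff m m') ∧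
      ∀ m ∈ maximizers l a q, ∀ m' ∈ maximizers l a q,
        exponentDiff m m' 0 ^ 2 + exponentDiff m m' 1 ^ 2 ≤ ν 0 ^ 2 + ν 1 ^ 2 := by
  have h := maximizers_nonempty l a q
  obtain ⟨p, hp, hmax⟩ := Finset.exists_max_image (maximizers l a q ×ˢ maximizers l a q)
    (fun p => exponentDiff p.1 p.2 0 ^ 2 + exponentDiff p.1 p.2 1 ^ 2) (h.product h)
  rw [Finset.mem_product] at hp
  exact ⟨_, ⟨_, hp.1, _, hp.2, rfl⟩, fun m hm m' hm' =>
    hmax (m, m') (Finset.mem_product.mpr ⟨hm, hm'⟩)⟩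

/-- At an edge point `q`: the normal vector, unique up to sign, of the edge through `q`, of lattice
length the weight of the edge.  It is the longest difference of two exponents which attain the
maximum, that is, the edge of the Newton subdivision dual to the edge through `q`. -/
def edgeNormal (l : ℕ) (a : ℕ × ℕ → ℝ) (q : Fin 2 → ℝ) : Fin 2 → ℤ :=
  (exists_longest l a q).choose

/-! ### The map `π̃` and its multiplicities -/

/-- The markings `x₁, …, x₄`. -/
abbrev firstFour {n : ℕ} (hn : 4 ≤ n) : Fin 4 → Fin n := Fin.castLE hn

/-- The markings `x₃, …, x_n` (`x_{i+1}` being the marking with the index `i : Fin n`). -/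
abbrev PointMarking (n : ℕ) : Type := {i : Fin n // 2 ≤ (i : ℕ)}

/-- The domain of `π̃`: the rational plane tropical curves of degree `d` with `n` markings, the first
two of which are mapped to the tropical curve of degree `l` with coefficients `a`. -/
structure Domain (d n : ℕ) (hn : 4 ≤ n) (l : ℕ) (a : ℕ × ℕ → ℝ) extends
    PlaneTropicalCurve (Fin n) where
  degree_eq : toPlaneTropicalCurve.degree = standardDegree d
  ev_first : toPlaneTropicalCurve.ev (firstFour hn 0) ∈ tropicalPlaneCurve l a
  ev_second : toPlaneTropicalCurve.ev (firstFour hn 1) ∈ tropicalPlaneCurve l a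

namespace Domain

variable {d n l : ℕ} {hn : 4 ≤ n} {a : ℕ × ℕ → ℝ} (C : Domain d n hn l a)

/-- The map `π̃ = ev₃ × ⋯ × ev_n × δ`. -/
def piTilde : (PointMarking n → Fin 2 → ℝ) × M4 :=
  (fun i => C.ev i.1, C.forget (firstFour hn))

/-- `C` is a general point of the domain, i.e. it lies in a cell of codimension zero: its
combinatorial type has codimension zero, and `x₁`, `x₂` are mapped to the relative interiors of edges
of the curve of degree `l`. -/
def IsGeneral : Prop :=
  C.IsTrivalent ∧ IsEdgePoint l a (C.ev (firstFour hn 0)) ∧ IsEdgePoint l a (C.ev (firstFour hn 1))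

/-- The coordinates of the cell of the moduli space of plane tropical curves given by the
combinatorial type of `C`: the position of the root vertex, for which the vertex at `x₁` is taken, and
the lengths of the bounded edges. -/
abbrev Coordinate : Type := Fin 2 ⊕ C.graph.edgeSet

/-- The unique path in the tree from the root vertex to `v`. -/
def pathTo (v : C.V) : C.graph.Walk (C.mark (firstFour hn 0)) v :=
  (C.isTree.existsUnique_path (C.mark (firstFour hn 0)) v).choose

open Classical in
/-- The coefficient of the coordinate `c` in the `j`-th component of the position of the vertex `v`,
which is the position of the root plus the sum, over the edges on the path from the root to `v`, of
the length times the direction vector. -/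
def posCoeff (v : C.V) (j : Fin 2) : C.Coordinate → ℝ
  | Sum.inl k => if k = j then 1 else 0
  | Sum.inr e =>
    (((C.pathTo v).darts.filter fun D => D.edge = e.1).map fun D => (C.dir D.fst D.snd j : ℝ)).sum

open Classical in
/-- The coefficient of the coordinate `c` in the length of the bounded edge of the four-marked curve
obtained by forgetting. -/
def forgetCoeff : C.Coordinate → ℝ
  | Sum.inl _ => 0
  | Sum.inr e =>
    if C.Separates e (firstFour hn 0) (firstFour hn 1) (firstFour hn 2) (firstFour hn 3) ∨
      C.Separates e (firstFour hn 0) (firstFour hn 2) (firstFour hn 1) (firstFour hn 3) ∨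
      C.Separates e (firstFour hn 0) (firstFour hn 3) (firstFour hn 1) (firstFour hn 2) then 1
    else 0

/-- The rows of the matrix of `π̃`: one for each of `x₁`, `x₂`, two for each of `x₃, …, x_n`, and one
for the coordinate of the moduli space of four-marked curves. -/
abbrev Row (n : ℕ) : Type := Fin 2 ⊕ (PointMarking n × Fin 2) ⊕ Unit

/-- The matrix of the linear map underlying `π̃` on the cell of `C`, together with the two conditions
that `x₁` and `x₂` stay on the edges of the curve of degree `l` on which they are: the row of `x₁`
(and likewise of `x₂`) is the evaluation at `x₁` in the direction normal to the edge through its image,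
scaled by the weight of this edge. -/
def matrix : Matrix (Row n) C.Coordinate ℝ
  | Sum.inl i, c => ∑ j : Fin 2,
      (edgeNormal l a (C.ev (firstFour hn (Fin.castLE (by omega) i))) j : ℝ)
        * C.posCoeff (C.mark (firstFour hn (Fin.castLE (by omega) i))) j c
  | Sum.inr (Sum.inl (i, j)), c => C.posCoeff (C.mark i.1) j c
  | Sum.inr (Sum.inr _), c => C.forgetCoeff c

open Classical in
/-- The multiplicity of `π̃` at a general point `C`: the absolute value of the determinant.  (The
matrix is a square matrix if `n = 3 * d` and `C` is trivalent; the absolute value does not depend on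
how the rows and columns are ordered.) -/
def mult : ℝ :=
  if h : Fintype.card (Row n) = Fintype.card C.Coordinate then
    |(C.matrix.submatrix id (Fintype.equivOfCardEq h)).det|
  else 0

/-- The markings `x₁` and `x₂` are adjacent to the same vertex. -/
def FirstTwoAdjacent : Prop := C.mark (firstFour hn 0) = C.mark (firstFour hn 1)

open Classical in
/-- `C` decomposes uniquely into `C₁` and `C₂`: it has exactly one contracted bounded edge, and the
two components of `C` split at this edge are curves `C₁`, `C₂` of degrees `d₁, d₂ > 0` with
`d₁ + d₂ = d`, such that `x₁, x₂` are on `C₁`, such that `x₃, x₄` are on `C₂`, and such that exactly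
`3 * d₁ - 1` of the markings `x₅, …, x_n` are on `C₁`. -/
def DecomposesUniquely : Prop :=
  ∃ E : C.ContractedEdge,
    (∀ E' : C.ContractedEdge, s(E'.fst, E'.snd) = s(E.fst, E.snd)) ∧
    ∃ d₁ d₂ : ℕ, 0 < d₁ ∧ 0 < d₂ ∧ d₁ + d₂ = d ∧
      E.component.degree = standardDegree d₁ ∧
      E.symm.component.degree = standardDegree d₂ ∧
      C.mark (firstFour hn 0) ∈ E.side ∧ C.mark (firstFour hn 1) ∈ E.side ∧
      C.mark (firstFour hn 2) ∈ E.symm.side ∧ C.mark (firstFour hn 3) ∈ E.symm.side ∧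
      {i : Fin n | 4 ≤ (i : ℕ) ∧ C.mark i ∈ E.side}.ncard = 3 * d₁ - 1

end Domain

end

end PlaneTropical

/-!
That the multiplicity of `C` does not vanish means that `C` is determined, within its
combinatorial type, by its image under `π̃`. Hence a contracted bounded edge, which can be
stretched without moving anything else, is unique and separates `x₁`, `x₂` from `x₃`, `x₄`; and a
component with `m` unbounded edges which had fewer than `m - 1` markings at given points could be
deformed, so that counting markings gives the decomposition in (b).

Assume now that there is no contracted bounded edge and that `x₁`, `x₂` are at different vertices.
There are only finitely many combinatorial types. If the length `t` is unbounded on one of them,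
then the curves of this type through the given points form a ray, on which no bounded edge gets
shorter and `x₁`, `x₂` run along unbounded edges of the curve of degree `l`, i.e. in standard
directions. After a symmetry permuting the three standard directions, some vertex moves to the
left. A connected set of vertices that are fastest to the left is pulled by its unbounded edges
against the edges to the rest of the curve. As the family is one-dimensional, at most two
unbounded edges can be attached to the set, and balancing then leaves only one possibility: the
only moving vertex is a leaf of the tree of bounded edges. The length of a bounded edge that
separates `x₁`, `x₂` from `x₃`, `x₄` can only change if it is the edge at this leaf. But `x₁` and
`x₂` are not both at the leaf, and the fixed marking `x₃` is not there either, so `t` is constant,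
a contradiction.
-/

namespace PlaneTropical

/-! ### Trees and their edges -/

section Graph

variable {V : Type*} {G : SimpleGraph V} {v w x y : V}

theorem exists_sym2_extension {α : Type*} (f : V → V → α)
    (hf : ∀ v w, G.Adj v w → f w v = f v w) :
    ∃ F : Sym2 V → α, ∀ v w, G.Adj v w → F s(v, w) = f v w := by
  refine ⟨fun e => f (Quot.out e).1 (Quot.out e).2, fun v w hvw => ?_⟩
  have hout : s((Quot.out s(v, w)).1, (Quot.out s(v, w)).2) = s(v, w) := Quot.out_eq _
  rcases Sym2.eq_iff.mp hout with ⟨hfst, hsnd⟩ | ⟨hfst, hsnd⟩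
  · simp only [hfst, hsnd]
  · simp only [hfst, hsnd, hf v w hvw]

theorem not_reachable_deleteEdges (hG : G.IsAcyclic) (hvw : G.Adj v w) :
    ¬ (G.deleteEdges {s(v, w)}).Reachable v w :=
  SimpleGraph.isBridge_iff.mp (SimpleGraph.isAcyclic_iff_forall_adj_isBridge.mp hG hvw)

theorem adj_deleteEdges (hxy : G.Adj x y) (hne : s(x, y) ≠ s(v, w)) :
    (G.deleteEdges {s(v, w)}).Adj x y :=
  SimpleGraph.deleteEdges_adj.mpr ⟨hxy, hne⟩

theorem eq_of_adj_of_reachable_deleteEdges (hG : G.IsAcyclic) (hvw : G.Adj v w)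
    (hxy : G.Adj x y) (hx : (G.deleteEdges {s(v, w)}).Reachable v x)
    (hy : ¬ (G.deleteEdges {s(v, w)}).Reachable v y) : x = v ∧ y = w := by
  by_cases hedge : s(x, y) = s(v, w)
  · rcases Sym2.eq_iff.mp hedge with h | ⟨rfl, rfl⟩
    · exact h
    · exact absurd hx (not_reachable_deleteEdges hG hvw)
  · exact absurd (hx.trans (adj_deleteEdges hxy hedge).reachable) hy

theorem reachable_deleteEdges_or (hG : G.Preconnected) (v w x : V) :
    (G.deleteEdges {s(v, w)}).Reachable v x ∨ (G.deleteEdges {s(v, w)}).Reachable w x := by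
  by_contra hx
  obtain ⟨p⟩ := hG v x
  obtain ⟨d, -, hfst, hsnd⟩ := p.exists_boundary_dart
    {y | (G.deleteEdges {s(v, w)}).Reachable v y ∨ (G.deleteEdges {s(v, w)}).Reachable w y}
    (Or.inl (SimpleGraph.Reachable.refl _)) hx
  by_cases hedge : s(d.fst, d.snd) = s(v, w)
  · rcases Sym2.eq_iff.mp hedge with ⟨-, h⟩ | ⟨-, h⟩
    · exact hsnd (Or.inr (by rw [h]))
    · exact hsnd (Or.inl (by rw [h]))
  · have hadj := (adj_deleteEdges d.adj hedge).reachable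
    exact hsnd (hfst.imp (fun h => h.trans hadj) fun h => h.trans hadj)

theorem reachable_deleteEdges_of_mem {e f : Sym2 V}
    (hf : ¬ (G.deleteEdges {f}).Reachable x y) (he : (G.deleteEdges {e}).Reachable x y)
    {z : V} (hz : z ∈ f) : (G.deleteEdges {e}).Reachable x z := by
  classical
  obtain ⟨p⟩ := he
  have hmem : f ∈ p.edges := by
    simpa using (p.mapLe (SimpleGraph.deleteEdges_le _)).mem_edges_of_not_reachable_deleteEdges hf
  exact ⟨p.takeUntil z (SimpleGraph.Walk.mem_support_of_mem_edges hmem hz)⟩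

theorem eq_of_subset_of_forall_adj_mem {S A : Set V} (hS : (G.induce S).Preconnected)
    (hAS : A ⊆ S) (hA : A.Nonempty) (hclosed : ∀ v ∈ A, ∀ w ∈ S, G.Adj v w → w ∈ A) : A = S := by
  refine hAS.antisymm fun w hw => ?_
  by_contra hwA
  obtain ⟨v, hv⟩ := hA
  obtain ⟨p⟩ := hS ⟨v, hAS hv⟩ ⟨w, hw⟩
  obtain ⟨d, -, hfst, hsnd⟩ := p.exists_boundary_dart {x | x.1 ∈ A} hv hwA
  exact hsnd (hclosed _ hfst _ d.snd.2 d.adj)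

theorem exists_connected_level_set {α : Type*} (G : SimpleGraph V) (f : V → α) (v₀ : V) :
    ∃ S : Set V, v₀ ∈ S ∧ (∀ v ∈ S, f v = f v₀) ∧ (G.induce S).Connected ∧
      ∀ v ∈ S, ∀ w ∉ S, G.Adj v w → f w ≠ f v₀ := by
  classical
  let S : Set V := {v | ∃ p : G.Walk v₀ v, ∀ x ∈ p.support, f x = f v₀}
  have hv₀ : v₀ ∈ S := ⟨SimpleGraph.Walk.nil, by simp⟩
  refine ⟨S, hv₀, fun v ⟨p, hp⟩ => hp v p.end_mem_support, ?_, ?_⟩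
  · refine SimpleGraph.induce_connected_of_patches v₀ hv₀ fun {v} ⟨p, hp⟩ => ?_
    refine ⟨{x | x ∈ p.support}, fun x hx => ?_, p.start_mem_support, p.end_mem_support,
      p.connected_induce_support _ _⟩
    exact ⟨p.takeUntil x hx, fun y hy => hp y (p.support_takeUntil_subset_support hx hy)⟩
  · rintro v ⟨p, hp⟩ w hw hvw hf
    refine hw ⟨p.concat hvw, fun x hx => ?_⟩
    rw [SimpleGraph.Walk.support_concat, List.mem_append, List.mem_singleton] at hx
    rcases hx with hx | rfl
    · exact hp x hx
    · exact hf

variable {S : Finset V}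

open Classical in
theorem card_edgeSet_induce_add_one (hS : (G.induce (S : Set V)).IsTree) :
    Fintype.card (G.induce (S : Set V)).edgeSet + 1 = S.card := by
  rw [← SimpleGraph.edgeFinset_card, hS.card_edgeFinset]
  simp

open Classical in
theorem sum_sum_adj_eq_two_mul_card_edgeSet (S : Finset V) :
    ∑ v ∈ S, ∑ w ∈ S, (if G.Adj v w then 1 else 0)
      = 2 * Fintype.card (G.induce (S : Set V)).edgeSet := by
  rw [← SimpleGraph.edgeFinset_card, ← SimpleGraph.sum_degrees_eq_twice_card_edges,
    ← Finset.sum_coe_sort S]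
  refine Finset.sum_congr rfl fun v _ => ?_
  rw [← Finset.sum_coe_sort S, ← SimpleGraph.card_neighborFinset_eq_degree, Finset.sum_boole,
    Nat.cast_id]
  congr 1
  ext w
  simp

variable (G) in
open Classical in
/-- The oriented edges which leave a set of vertices. -/
noncomputable def boundary [Fintype V] (S : Finset V) : Finset (V × V) :=
  (S ×ˢ Sᶜ).filter fun p => G.Adj p.1 p.2

variable (G) in
open Classical in
/-- The vertices on the side of `v` after the removal of the edge between `v` and `w`. -/
noncomputable def edgeSide [Fintype V] (v w : V) : Finset V :=
  {x | (G.deleteEdges {s(v, w)}).Reachable v x}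

variable [Fintype V]

theorem mem_boundary {p : V × V} : p ∈ boundary G S ↔ p.1 ∈ S ∧ p.2 ∉ S ∧ G.Adj p.1 p.2 := by
  simp [boundary, and_assoc]

theorem boundary_nonempty (hG : G.Preconnected) (hv : v ∈ S) (hw : w ∉ S) :
    (boundary G S).Nonempty := by
  obtain ⟨p⟩ := hG v w
  obtain ⟨d, -, hfst, hsnd⟩ := p.exists_boundary_dart (S : Set V) hv hw
  exact ⟨(d.fst, d.snd), mem_boundary.mpr ⟨hfst, hsnd, d.adj⟩⟩

theorem mem_edgeSide : x ∈ edgeSide G v w ↔ (G.deleteEdges {s(v, w)}).Reachable v x := by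
  simp [edgeSide]

theorem left_mem_edgeSide : v ∈ edgeSide G v w := mem_edgeSide.mpr (SimpleGraph.Reachable.refl _)

theorem right_notMem_edgeSide (hG : G.IsAcyclic) (hvw : G.Adj v w) : w ∉ edgeSide G v w :=
  fun h => not_reachable_deleteEdges hG hvw (mem_edgeSide.mp h)

theorem boundary_edgeSide (hG : G.IsAcyclic) (hvw : G.Adj v w) :
    boundary G (edgeSide G v w) = {(v, w)} := by
  ext ⟨x, y⟩
  rw [mem_boundary, Finset.mem_singleton, Prod.mk.injEq]
  constructor
  · rintro ⟨hx, hy, hxy⟩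
    rw [mem_edgeSide] at hx hy
    exact eq_of_adj_of_reachable_deleteEdges hG hvw hxy hx hy
  · rintro ⟨rfl, rfl⟩
    exact ⟨left_mem_edgeSide, right_notMem_edgeSide hG hvw, hvw⟩

open Classical in
theorem sum_sum_adj_eq_add_sum_boundary {M : Type*} [AddCommMonoid M] (S : Finset V)
    (f : V → V → M) :
    ∑ v ∈ S, ∑ w, (if G.Adj v w then f v w else 0)
      = ∑ v ∈ S, ∑ w ∈ S, (if G.Adj v w then f v w else 0)
        + ∑ p ∈ boundary G S, f p.1 p.2 := by
  rw [boundary, Finset.sum_filter, Finset.sum_product, ← Finset.sum_add_distrib]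
  exact Finset.sum_congr rfl fun v _ => (Finset.sum_add_sum_compl S _).symm

open Classical in
theorem sum_sum_adj_eq_sum_boundary {M : Type*} [AddCommGroup M] [IsAddTorsionFree M]
    (S : Finset V) (f : V → V → M) (hf : ∀ v w, G.Adj v w → f w v = -f v w) :
    ∑ v ∈ S, ∑ w, (if G.Adj v w then f v w else 0) = ∑ p ∈ boundary G S, f p.1 p.2 := by
  rw [sum_sum_adj_eq_add_sum_boundary, add_eq_right, ← self_eq_neg]
  conv_lhs => rw [Finset.sum_comm]
  simp only [← Finset.sum_neg_distrib]
  refine Finset.sum_congr rfl fun v _ => Finset.sum_congr rfl fun w _ => ?_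
  by_cases hvw : G.Adj v w
  · rw [if_pos hvw, if_pos hvw.symm, hf v w hvw]
  · rw [if_neg hvw, if_neg fun h => hvw h.symm, neg_zero]

open Classical in
theorem sum_sum_adj_add_two_of_isTree (hS : (G.induce (S : Set V)).IsTree) :
    ∑ v ∈ S, ∑ w, (if G.Adj v w then 1 else 0) + 2 = 2 * S.card + (boundary G S).card := by
  rw [sum_sum_adj_eq_add_sum_boundary, sum_sum_adj_eq_two_mul_card_edgeSet,
    ← card_edgeSet_induce_add_one hS, Finset.card_eq_sum_ones]
  ring

end Graph

/-! ### Linear functionals with few conditions -/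

theorem exists_ne_zero_of_card_lt_finrank {K E ι : Type*} [Field K] [AddCommGroup E] [Module K E]
    [FiniteDimensional K E] [Fintype ι] (g : ι → Module.Dual K E)
    (hι : Fintype.card ι < Module.finrank K E) : ∃ x ≠ 0, ∀ i, g i x = 0 := by
  have hker := LinearMap.ker_ne_bot_of_finrank_lt (f := LinearMap.pi g) (by simpa using hι)
  obtain ⟨x, hx, hx0⟩ := Submodule.exists_mem_ne_zero_of_ne_bot hker
  exact ⟨x, hx0, fun i => congrFun (LinearMap.mem_ker.mp hx) i⟩

namespace PlaneTropicalCurve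

/-! ### Balancing and the Euler characteristic -/

section

variable {I : Type} [Fintype I] (C : PlaneTropicalCurve I)

theorem isAcyclic : C.graph.IsAcyclic := C.isTree.isAcyclic

theorem preconnected : C.graph.Preconnected := C.isTree.connected.preconnected

theorem dir_swap {v w : C.V} (hvw : C.graph.Adj v w) : C.dir w v = -C.dir v w := by
  funext j
  have hlen : C.len s(v, w) ≠ 0 := (C.len_pos _ hvw).ne'
  have hmul : C.len s(v, w) * ((C.dir v w j : ℝ) + C.dir w v j) = 0 := by
    have hback := C.pos_sub _ _ hvw.symm j
    rw [Sym2.eq_swap] at hback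
    linarith [C.pos_sub _ _ hvw j]
  have hsum : C.dir v w j + C.dir w v j = 0 := by
    exact_mod_cast (mul_eq_zero.mp hmul).resolve_left hlen
  rw [Pi.neg_apply]
  omega

open Classical in
/-- The unmarked unbounded edges at a set of vertices. -/
noncomputable def endsIn (S : Finset C.V) : Finset C.U := {u | C.endAt u ∈ S}

open Classical in
/-- The markings at a set of vertices. -/
noncomputable def marksIn (S : Finset C.V) : Finset I := {i | C.mark i ∈ S}

variable {C} in
theorem mem_endsIn {S : Finset C.V} {u : C.U} : u ∈ C.endsIn S ↔ C.endAt u ∈ S := by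
  simp [endsIn]

variable {C} in
theorem mem_marksIn {S : Finset C.V} {i : I} : i ∈ C.marksIn S ↔ C.mark i ∈ S := by
  simp [marksIn]

open Classical in
theorem sum_sum_ite_eq_sum_filter {X V M : Type*} [Fintype X] [AddCommMonoid M] (S : Finset V)
    (g : X → V) (f : X → M) :
    ∑ v ∈ S, ∑ u, (if g u = v then f u else 0) = ∑ u with g u ∈ S, f u := by
  rw [Finset.sum_comm, Finset.sum_filter]
  exact Finset.sum_congr rfl fun u _ => Finset.sum_ite_eq ..

theorem sum_boundary_dir_add_sum_endDir (S : Finset C.V) :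
    ∑ p ∈ boundary C.graph S, C.dir p.1 p.2 + ∑ u ∈ C.endsIn S, C.endDir u = 0 := by
  classical
  have hbalanced : ∑ v ∈ S, ((∑ w, if C.graph.Adj v w then C.dir v w else 0)
      + (∑ u, if C.endAt u = v then C.endDir u else 0)) = 0 :=
    Finset.sum_eq_zero fun v _ => by convert C.balanced v
  rw [Finset.sum_add_distrib, sum_sum_ite_eq_sum_filter] at hbalanced
  rw [← sum_sum_adj_eq_sum_boundary S C.dir fun v w hvw => C.dir_swap hvw, endsIn]
  convert hbalanced

theorem sum_boundary_dir_apply_add_sum_endDir_apply (S : Finset C.V) (j : Fin 2) :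
    ∑ p ∈ boundary C.graph S, C.dir p.1 p.2 j + ∑ u ∈ C.endsIn S, C.endDir u j = 0 := by
  simpa only [Pi.add_apply, Finset.sum_apply, Pi.zero_apply]
    using congrFun (C.sum_boundary_dir_add_sum_endDir S) j

variable {C}

theorem IsTrivalent.card_add_two (hC : C.IsTrivalent) {S : Finset C.V}
    (hS : (C.graph.induce (S : Set C.V)).IsTree) :
    S.card + 2 = (boundary C.graph S).card + (C.endsIn S).card + (C.marksIn S).card := by
  classical
  have hvalence : ∑ v ∈ S, C.valence v = 3 * S.card := by
    rw [Finset.sum_congr rfl fun v _ => hC v, Finset.sum_const, smul_eq_mul, mul_comm]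
  simp only [valence, Finset.sum_add_distrib, sum_sum_ite_eq_sum_filter] at hvalence
  have hedges := sum_sum_adj_add_two_of_isTree hS
  simp only [endsIn, marksIn, Finset.card_eq_sum_ones] at hvalence hedges ⊢
  omega

/-- The side of `vw` within `S` is left only through `vw` and through flags that leave `S`, so that
its balancing condition isolates the direction of `vw`. -/
theorem dir_apply_eq_zero_of_boundary {S : Finset C.V} {j : Fin 2}
    (hboundary : ∀ p ∈ boundary C.graph S, C.dir p.1 p.2 j = 0)
    (hends : ∀ u ∈ C.endsIn S, C.endDir u j = 0)
    {v w : C.V} (hv : v ∈ S) (hvw : C.graph.Adj v w) : C.dir v w j = 0 := by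
  classical
  set A := S ∩ edgeSide C.graph v w
  have hendsA : ∑ u ∈ C.endsIn A, C.endDir u j = 0 := Finset.sum_eq_zero fun u hu =>
    hends u (mem_endsIn.mpr (Finset.mem_inter.mp (mem_endsIn.mp hu)).1)
  have hboundaryA : ∑ p ∈ boundary C.graph A, C.dir p.1 p.2 j = C.dir v w j := by
    refine Finset.sum_eq_single (v, w) ?_ fun hmem => absurd (mem_boundary.mpr ⟨?_, ?_, hvw⟩) hmem
    · rintro ⟨x, y⟩ hp hne
      obtain ⟨hx, hy, hxy⟩ := mem_boundary.mp hp
      obtain ⟨hxS, hxside⟩ := Finset.mem_inter.mp hx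
      by_cases hyS : y ∈ S
      · have hleaves : (x, y) ∈ boundary C.graph (edgeSide C.graph v w) :=
          mem_boundary.mpr ⟨hxside, fun hyside => hy (Finset.mem_inter.mpr ⟨hyS, hyside⟩), hxy⟩
        rw [boundary_edgeSide C.isAcyclic hvw, Finset.mem_singleton] at hleaves
        exact absurd hleaves hne
      · exact hboundary (x, y) (mem_boundary.mpr ⟨hxS, hyS, hxy⟩)
    · exact Finset.mem_inter.mpr ⟨hv, left_mem_edgeSide⟩
    · exact fun hmem => right_notMem_edgeSide C.isAcyclic hvw (Finset.mem_inter.mp hmem).2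
  have hbalance := C.sum_boundary_dir_apply_add_sum_endDir_apply A j
  omega

end

/-! ### Infinitesimal deformations -/

section

variable {I : Type} [Fintype I] (C : PlaneTropicalCurve I)

/-- The determinant of the direction of the edge `vw` and of the change of `pos w - pos v` under the
displacement `D` of the vertices.  For an edge which is not contracted, it vanishes if and only if
the displaced edge keeps its direction. -/
def bend (v w : C.V) : Module.Dual ℝ (C.V → Fin 2 → ℝ) where
  toFun D := C.dir v w 0 * (D w 1 - D v 1) - C.dir v w 1 * (D w 0 - D v 0)
  map_add' D D' := by simp only [Pi.add_apply]; ring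
  map_smul' c D := by simp only [Pi.smul_apply, smul_eq_mul, RingHom.id_apply]; ring

theorem bend_apply (v w : C.V) (D : C.V → Fin 2 → ℝ) :
    C.bend v w D = C.dir v w 0 * (D w 1 - D v 1) - C.dir v w 1 * (D w 0 - D v 0) := rfl

theorem bend_swap {v w : C.V} (hvw : C.graph.Adj v w) : C.bend w v = C.bend v w := by
  ext D
  simp only [bend_apply, C.dir_swap hvw, Pi.neg_apply, Int.cast_neg]
  ring

variable {C} in
theorem bend_eq_zero_of_eq {v w : C.V} {D : C.V → Fin 2 → ℝ} (h : D v = D w) :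
    C.bend v w D = 0 := by
  rw [bend_apply, h]; ring

/-- The pairs of a displacement `D` of the vertices and a change `ℓ` of the lengths of the bounded
edges that belong together: the tangent space of the cell of `C`, with contracted edges of variable
length. -/
def variations : Submodule ℝ ((C.V → Fin 2 → ℝ) × (Sym2 C.V → ℝ)) where
  carrier := {x | ∀ v w, C.graph.Adj v w → ∀ j, x.1 w j - x.1 v j = x.2 s(v, w) * C.dir v w j}
  add_mem' hx hy v w hvw j := by
    simp only [Prod.fst_add, Prod.snd_add, Pi.add_apply]
    linear_combination hx v w hvw j + hy v w hvw j
  zero_mem' := by simp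
  smul_mem' c x hx v w hvw j := by
    simp only [Prod.smul_fst, Prod.smul_snd, Pi.smul_apply, smul_eq_mul]
    linear_combination c * hx v w hvw j

/-- The infinitesimal deformations of `C`, as displacements of the vertices, for which the markings
in `P` are fixed and every other marking `i` moves orthogonally to `ν i`. -/
def deformations (P : I → Prop) (ν : I → Fin 2 → ℝ) : Submodule ℝ (C.V → Fin 2 → ℝ) where
  carrier := {D | (∀ v w, C.graph.Adj v w → C.bend v w D = 0) ∧ (∀ i, P i → D (C.mark i) = 0) ∧
    ∀ i, ¬ P i → ν i ⬝ᵥ D (C.mark i) = 0}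
  add_mem' := by
    rintro D D' ⟨hbend, hfixed, hnormal⟩ ⟨hbend', hfixed', hnormal'⟩
    exact ⟨fun v w hvw => by rw [map_add, hbend v w hvw, hbend' v w hvw, add_zero],
      fun i hi => by rw [Pi.add_apply, hfixed i hi, hfixed' i hi, add_zero],
      fun i hi => by rw [Pi.add_apply, dotProduct_add, hnormal i hi, hnormal' i hi, add_zero]⟩
  zero_mem' := by simp
  smul_mem' := by
    rintro c D ⟨hbend, hfixed, hnormal⟩
    exact ⟨fun v w hvw => by rw [map_smul, hbend v w hvw, smul_zero],
      fun i hi => by rw [Pi.smul_apply, hfixed i hi, smul_zero],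
      fun i hi => by rw [Pi.smul_apply, dotProduct_smul, hnormal i hi, smul_zero]⟩

variable {C} {P : I → Prop} {ν : I → Fin 2 → ℝ} {D : C.V → Fin 2 → ℝ} {ℓ : Sym2 C.V → ℝ}

theorem mem_variations : (D, ℓ) ∈ C.variations ↔
    ∀ v w, C.graph.Adj v w → ∀ j, D w j - D v j = ℓ s(v, w) * C.dir v w j := Iff.rfl

theorem mem_deformations : D ∈ C.deformations P ν ↔
    (∀ v w, C.graph.Adj v w → C.bend v w D = 0) ∧ (∀ i, P i → D (C.mark i) = 0) ∧
      ∀ i, ¬ P i → ν i ⬝ᵥ D (C.mark i) = 0 := Iff.rfl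

theorem bend_eq_zero_of_mem_variations (h : (D, ℓ) ∈ C.variations) {v w : C.V}
    (hvw : C.graph.Adj v w) : C.bend v w D = 0 := by
  rw [bend_apply, h v w hvw 0, h v w hvw 1]
  ring

theorem exists_mul_eq_of_det_eq_zero {x e : Fin 2 → ℝ} (he : e ≠ 0)
    (hdet : e 0 * x 1 - e 1 * x 0 = 0) : ∃ r : ℝ, ∀ j, x j = r * e j := by
  have hnorm : e 0 * e 0 + e 1 * e 1 ≠ 0 := by
    rw [← Fin.sum_univ_two fun j => e j * e j]
    exact mt dotProduct_self_eq_zero.mp he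
  refine ⟨(x 0 * e 0 + x 1 * e 1) / (e 0 * e 0 + e 1 * e 1), fun j => ?_⟩
  rw [div_mul_eq_mul_div, eq_div_iff hnorm]
  fin_cases j
  · simp only [Fin.zero_eta]; linear_combination -e 1 * hdet
  · simp only [Fin.mk_one]; linear_combination e 0 * hdet

theorem exists_mem_variations (hbend : ∀ v w, C.graph.Adj v w → C.bend v w D = 0)
    (hcontracted : ∀ v w, C.graph.Adj v w → C.dir v w = 0 → D v = D w) :
    ∃ ℓ, (D, ℓ) ∈ C.variations := by
  have hstretch : ∀ v w, ∃ r : ℝ, C.graph.Adj v w →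
      ∀ j, D w j - D v j = r * C.dir v w j := by
    intro v w
    by_cases hvw : C.graph.Adj v w
    · by_cases hdir : C.dir v w = 0
      · exact ⟨0, fun _ j => by rw [hcontracted v w hvw hdir]; simp⟩
      · obtain ⟨r, hr⟩ := exists_mul_eq_of_det_eq_zero (x := fun j => D w j - D v j)
          (e := fun j => (C.dir v w j : ℝ))
          (fun h => hdir (funext fun j => Int.cast_eq_zero.mp (congrFun h j))) (hbend v w hvw)
        exact ⟨r, fun _ => hr⟩
    · exact ⟨0, fun h => absurd h hvw⟩
  choose r hr using hstretch
  refine ⟨fun e => r (Quot.out e).1 (Quot.out e).2, fun v w hvw j => ?_⟩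
  have hout : s((Quot.out s(v, w)).1, (Quot.out s(v, w)).2) = s(v, w) := Quot.out_eq _
  rcases Sym2.eq_iff.mp hout with ⟨hfst, hsnd⟩ | ⟨hfst, hsnd⟩
  · simp only [hfst, hsnd, hr v w hvw j]
  · simp only [hfst, hsnd]
    have := hr w v hvw.symm j
    rw [C.dir_swap hvw] at this
    push_cast [Pi.neg_apply] at this
    linarith

/-- An edge has one condition and a vertex two unknowns, so that a tree `S` admits `S.card`
further conditions. -/
theorem exists_displacement_of_isTree {S : Finset C.V}
    (hS : (C.graph.induce (S : Set C.V)).IsTree) {J : Type*} [Fintype J]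
    (g : J → Module.Dual ℝ (C.V → Fin 2 → ℝ)) (hJ : Fintype.card J ≤ S.card) :
    ∃ D ≠ 0, (∀ v ∉ S, D v = 0) ∧
      (∀ v ∈ S, ∀ w ∈ S, C.graph.Adj v w → C.bend v w D = 0) ∧ ∀ j, g j D = 0 := by
  classical
  obtain ⟨edgeBend, hedgeBend⟩ := exists_sym2_extension C.bend fun v w => C.bend_swap
  have hcard := card_edgeSet_induce_add_one hS
  have hcompl := Finset.card_add_card_compl S
  obtain ⟨D, hD0, hD⟩ := exists_ne_zero_of_card_lt_finrank
    (ι := ((Sᶜ : Finset C.V) × Fin 2) ⊕ (C.graph.induce (S : Set C.V)).edgeSet ⊕ J)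
    (E := C.V → Fin 2 → ℝ)
    (Sum.elim (fun x => LinearMap.proj x.2 ∘ₗ LinearMap.proj x.1.1)
      (Sum.elim (fun e => edgeBend (e.1.map Subtype.val)) g)) (by
    simp only [Fintype.card_sum, Fintype.card_prod, Fintype.card_coe, Fintype.card_fin,
      Module.finrank_pi_fintype, Module.finrank_self, Finset.sum_const, Finset.card_univ,
      smul_eq_mul]
    omega)
  refine ⟨D, hD0, fun v hv => funext fun j => hD (.inl (⟨v, Finset.mem_compl.mpr hv⟩, j)),
    fun v hv w hw hvw => ?_, fun j => hD (.inr (.inr j))⟩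
  have hedge := hD (.inr (.inl ⟨s(⟨v, hv⟩, ⟨w, hw⟩), hvw⟩))
  simp only [Sum.elim_inr, Sum.elim_inl, Sym2.map_mk] at hedge
  rwa [hedgeBend v w hvw] at hedge

variable (C) in
/-- The velocity of the marking `i` in the direction of `ν`, as a linear functional. -/
def normalVelocity (ν : Fin 2 → ℝ) (i : I) : Module.Dual ℝ (C.V → Fin 2 → ℝ) :=
  (dotProductBilin ℝ ℝ ν) ∘ₗ LinearMap.proj (C.mark i)

theorem exists_mem_deformations_of_isTree (hC : C.IsTrivalent) {S : Finset C.V}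
    (hS : (C.graph.induce (S : Set C.V)).IsTree) (hP : ∀ i, P i → C.mark i ∉ S)
    {J : Type*} [Fintype J] (g : J → Module.Dual ℝ (C.V → Fin 2 → ℝ))
    (hJ : Fintype.card J + 2 ≤ (C.endsIn S).card) :
    ∃ D ≠ 0, D ∈ C.deformations P ν ∧ (∀ v ∉ S, D v = 0) ∧ ∀ j, g j D = 0 := by
  classical
  obtain ⟨D, hD0, hDS, hbend, hD⟩ := exists_displacement_of_isTree hS
    (J := boundary C.graph S ⊕ C.marksIn S ⊕ J)
    (Sum.elim (fun p => C.bend p.1.1 p.1.2) (Sum.elim (fun i => C.normalVelocity (ν i) i) g)) (by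
      simp only [Fintype.card_sum, Fintype.card_coe]
      linarith [hC.card_add_two hS])
  refine ⟨D, hD0, ⟨fun v w hvw => ?_, fun i hi => hDS _ (hP i hi), fun i _ => ?_⟩, hDS,
    fun j => hD (.inr (.inr j))⟩
  · by_cases hv : v ∈ S <;> by_cases hw : w ∈ S
    · exact hbend v hv w hw hvw
    · exact hD (.inl ⟨(v, w), mem_boundary.mpr ⟨hv, hw, hvw⟩⟩)
    · rw [← C.bend_swap hvw]
      exact hD (.inl ⟨(w, v), mem_boundary.mpr ⟨hw, hv, hvw.symm⟩⟩)
    · exact bend_eq_zero_of_eq (by rw [hDS v hv, hDS w hw])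
  · by_cases hi : C.mark i ∈ S
    · exact hD (.inr (.inl ⟨i, mem_marksIn.mpr hi⟩))
    · rw [hDS _ hi, dotProduct_zero]

end

end PlaneTropicalCurve

/-! ### Standard directions -/

/-- The directions of the unmarked unbounded edges of a plane curve of degree `d`. -/
def IsStandardDir (e : Fin 2 → ℤ) : Prop := e = ![-1, 0] ∨ e = ![0, -1] ∨ e = ![1, 1]

theorem exists_eq_replicate_of_isStandardDir {m : Multiset (Fin 2 → ℤ)}
    (h : ∀ e ∈ m, IsStandardDir e) :
    ∃ p q s : ℕ, m = Multiset.replicate p ![-1, 0] + Multiset.replicate q ![0, -1]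
      + Multiset.replicate s ![1, 1] := by
  induction m using Multiset.induction_on with
  | empty => exact ⟨0, 0, 0, by simp⟩
  | cons e m ih =>
    obtain ⟨p, q, s, rfl⟩ := ih fun e' he' => h e' (Multiset.mem_cons_of_mem he')
    rcases h e (Multiset.mem_cons_self _ _) with rfl | rfl | rfl
    · exact ⟨p + 1, q, s, by simp [Multiset.replicate_succ]⟩
    · exact ⟨p, q + 1, s, by simp [Multiset.replicate_succ]⟩
    · exact ⟨p, q, s + 1, by simp [Multiset.replicate_succ]⟩

namespace PlaneTropicalCurve

variable {I : Type} [Fintype I] {C : PlaneTropicalCurve I}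

theorem exists_map_endDir_endsIn (hends : ∀ u, IsStandardDir (C.endDir u)) (S : Finset C.V) :
    ∃ p q s : ℕ, (C.endsIn S).val.map C.endDir = Multiset.replicate p ![-1, 0]
      + Multiset.replicate q ![0, -1] + Multiset.replicate s ![1, 1] ∧
      (C.endsIn S).card = p + q + s ∧
      ∑ u ∈ C.endsIn S, C.endDir u 0 = s - p ∧ ∑ u ∈ C.endsIn S, C.endDir u 1 = s - q := by
  obtain ⟨p, q, s, hmap⟩ := exists_eq_replicate_of_isStandardDir
    (m := (C.endsIn S).val.map C.endDir) fun e he => by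
      obtain ⟨u, -, rfl⟩ := Multiset.mem_map.mp he
      exact hends u
  have hsum : ∀ j, ∑ u ∈ C.endsIn S, C.endDir u j
      = (((C.endsIn S).val.map C.endDir).map fun e => e j).sum := fun j => by
    rw [Multiset.map_map]
    rfl
  refine ⟨p, q, s, hmap, ?_, ?_, ?_⟩
  · simpa using congrArg Multiset.card hmap
  · rw [hsum, hmap]; simp; ring
  · rw [hsum, hmap]; simp; ring

/-! ### Unbounded deformations -/

/-- The tangent vector of a ray of curves in a one-dimensional fiber: the displacement `D` of the
vertices and the change `ℓ` of the lengths span the deformations of `C`, and they can be continued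
without end, so that no bounded edge gets shorter and the markings that are not fixed move away
along rays in standard directions. -/
structure IsUnboundedDeformation (C : PlaneTropicalCurve I) (P : I → Prop) (ν : I → Fin 2 → ℝ)
    (D : C.V → Fin 2 → ℝ) (ℓ : Sym2 C.V → ℝ) : Prop where
  mem_variations : (D, ℓ) ∈ C.variations
  len_nonneg : ∀ v w, C.graph.Adj v w → 0 ≤ ℓ s(v, w)
  mem_deformations : D ∈ C.deformations P ν
  deformations_le : C.deformations P ν ≤ ℝ ∙ D
  exists_fixed : ∃ i, P i
  recession : ∀ i, ¬ P i → ∃ s : ℝ, 0 ≤ s ∧ ∃ e, IsStandardDir e ∧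
    D (C.mark i) = s • fun j => (e j : ℝ)

/-- The vertex `v` is adjacent to at most one bounded edge, and it is the only vertex with a
displacement. -/
def IsMovingLeaf (C : PlaneTropicalCurve I) (D : C.V → Fin 2 → ℝ) (v : C.V) : Prop :=
  (∀ w ≠ v, D w = 0) ∧ ∀ w w', C.graph.Adj v w → C.graph.Adj v w' → w = w'

/-- A connected set of vertices that move to the left, at one speed and faster than the vertices
adjacent to this set. -/
structure IsLeftmost (C : PlaneTropicalCurve I) (D : C.V → Fin 2 → ℝ) (S : Finset C.V) : Prop where
  isTree : (C.graph.induce (S : Set C.V)).IsTree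
  neg : ∀ v ∈ S, D v 0 < 0
  apply_eq : ∀ v ∈ S, ∀ w ∈ S, D v 0 = D w 0
  lt : ∀ p ∈ boundary C.graph S, D p.1 0 < D p.2 0

section

variable {P : I → Prop} {ν : I → Fin 2 → ℝ} {D : C.V → Fin 2 → ℝ} {ℓ : Sym2 C.V → ℝ}
  {S : Finset C.V}

theorem exists_isLeftmost {v : C.V} (hv : D v 0 < 0) : ∃ S, C.IsLeftmost D S := by
  classical
  obtain ⟨v₀, -, hmin⟩ := Finset.exists_min_image Finset.univ (fun v => D v 0)
    ⟨v, Finset.mem_univ _⟩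
  obtain ⟨S, -, hlevel, hconnected, hleave⟩ :=
    exists_connected_level_set C.graph (fun v => D v 0) v₀
  refine ⟨S.toFinset, ⟨?_, C.isAcyclic.induce _⟩, fun w hw => ?_, fun w hw x hx => ?_, ?_⟩
  · rwa [Set.coe_toFinset]
  · rw [hlevel w (Set.mem_toFinset.mp hw)]
    exact (hmin v (Finset.mem_univ _)).trans_lt hv
  · rw [hlevel w (Set.mem_toFinset.mp hw), hlevel x (Set.mem_toFinset.mp hx)]
  · rintro ⟨w, x⟩ hp
    obtain ⟨hw, hx, hwx⟩ := mem_boundary.mp hp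
    rw [Set.mem_toFinset] at hw hx
    rw [hlevel w hw]
    exact lt_of_le_of_ne (hmin x (Finset.mem_univ _)) (hleave w hw x hx hwx).symm

theorem IsLeftmost.nonempty (hS : C.IsLeftmost D S) : S.Nonempty :=
  Set.nonempty_coe_sort.mp hS.isTree.connected.nonempty

namespace IsUnboundedDeformation

theorem sub_apply (h : C.IsUnboundedDeformation P ν D ℓ) {v w : C.V} (hvw : C.graph.Adj v w)
    (j : Fin 2) : D w j - D v j = ℓ s(v, w) * C.dir v w j := h.mem_variations v w hvw j

theorem mark_apply_one_eq_zero (h : C.IsUnboundedDeformation P ν D ℓ) {i : I} (hi : ¬ P i)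
    (hneg : D (C.mark i) 0 < 0) : D (C.mark i) 1 = 0 := by
  obtain ⟨s, hs, e, he, hD⟩ := h.recession i hi
  rw [hD] at hneg ⊢
  rcases he with rfl | rfl | rfl
  · simp
  · simp at hneg
  · exact absurd hneg (by simpa using hs)

theorem mark_notMem (h : C.IsUnboundedDeformation P ν D ℓ) (hS : C.IsLeftmost D S) (i : I)
    (hi : P i) : C.mark i ∉ S := fun hmem => by
  have := hS.neg _ hmem
  rw [h.mem_deformations.2.1 i hi] at this
  exact lt_irrefl _ this

theorem card_boundary_pos (h : C.IsUnboundedDeformation P ν D ℓ) (hS : C.IsLeftmost D S) :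
    0 < (boundary C.graph S).card := by
  obtain ⟨i, hi⟩ := h.exists_fixed
  obtain ⟨v, hv⟩ := hS.nonempty
  exact Finset.card_pos.mpr (boundary_nonempty C.preconnected hv (h.mark_notMem hS i hi))

theorem len_mul_dir_pos_of_mem_boundary (h : C.IsUnboundedDeformation P ν D ℓ)
    (hS : C.IsLeftmost D S) {p : C.V × C.V} (hp : p ∈ boundary C.graph S) :
    0 < ℓ s(p.1, p.2) * (C.dir p.1 p.2 0 : ℝ) := by
  rw [← h.sub_apply (mem_boundary.mp hp).2.2 0]
  exact sub_pos.mpr (hS.lt p hp)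

theorem one_le_dir_of_mem_boundary (h : C.IsUnboundedDeformation P ν D ℓ)
    (hS : C.IsLeftmost D S) {p : C.V × C.V} (hp : p ∈ boundary C.graph S) :
    1 ≤ C.dir p.1 p.2 0 := by
  have : (0 : ℝ) < C.dir p.1 p.2 0 := pos_of_mul_pos_right
    (h.len_mul_dir_pos_of_mem_boundary hS hp) (h.len_nonneg _ _ (mem_boundary.mp hp).2.2)
  exact_mod_cast this

theorem len_pos_of_mem_boundary (h : C.IsUnboundedDeformation P ν D ℓ)
    (hS : C.IsLeftmost D S) {p : C.V × C.V} (hp : p ∈ boundary C.graph S) :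
    0 < ℓ s(p.1, p.2) :=
  pos_of_mul_pos_left (h.len_mul_dir_pos_of_mem_boundary hS hp)
    (by exact_mod_cast zero_le_one.trans (h.one_le_dir_of_mem_boundary hS hp))

/-- With three unbounded edges, `S` has a deformation that keeps the horizontal position of a
vertex of `S`; it is not a multiple of `D`. -/
theorem card_endsIn_le_two (h : C.IsUnboundedDeformation P ν D ℓ) (hC : C.IsTrivalent)
    (hS : C.IsLeftmost D S) : (C.endsIn S).card ≤ 2 := by
  by_contra! hcard
  obtain ⟨v, hv⟩ := hS.nonempty
  obtain ⟨D', hD'0, hD', -, hfixed⟩ := exists_mem_deformations_of_isTree (ν := ν) hC hS.isTree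
    (h.mark_notMem hS) (fun _ : Unit => LinearMap.proj 0 ∘ₗ LinearMap.proj v)
    (by rw [Fintype.card_unit]; omega)
  obtain ⟨c, rfl⟩ := Submodule.mem_span_singleton.mp (h.deformations_le hD')
  have hc : c * D v 0 = 0 := hfixed ()
  exact hD'0 (by rw [(mul_eq_zero.mp hc).resolve_right (hS.neg v hv).ne, zero_smul])

theorem eq_zero_of_card_endsIn_eq_two (h : C.IsUnboundedDeformation P ν D ℓ)
    (hC : C.IsTrivalent) (hS : C.IsLeftmost D S) (hcard : (C.endsIn S).card = 2)
    {v : C.V} (hv : v ∉ S) : D v = 0 := by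
  obtain ⟨D', hD'0, hD', hsupport, -⟩ := exists_mem_deformations_of_isTree (ν := ν) hC hS.isTree
    (h.mark_notMem hS) (fun e : Empty => e.elim)
    (by rw [Fintype.card_empty]; omega)
  obtain ⟨c, rfl⟩ := Submodule.mem_span_singleton.mp (h.deformations_le hD')
  have hc : c • D v = 0 := hsupport v hv
  exact (smul_eq_zero.mp hc).resolve_left fun hc0 => hD'0 (by rw [hc0, zero_smul])

/-- The horizontal displacement of `v` alone is a deformation. -/
theorem eq_zero_of_forall_dir_eq_zero (h : C.IsUnboundedDeformation P ν D ℓ) {v : C.V}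
    (hv : D v 0 < 0) (hflag : ∀ w, C.graph.Adj v w → C.dir v w 1 = 0) {w : C.V} (hw : w ≠ v) :
    D w = 0 := by
  classical
  have hsingle : ∀ x ≠ v, (Pi.single v ![1, 0] : C.V → Fin 2 → ℝ) x = 0 :=
    fun x hx => Pi.single_eq_of_ne hx _
  have hbend : ∀ y, C.graph.Adj v y → C.bend v y (Pi.single v ![1, 0]) = 0 := fun y hvy => by
    rw [bend_apply, hsingle y hvy.ne', Pi.single_eq_same, hflag y hvy]
    simp
  have hmem : (Pi.single v ![1, 0] : C.V → Fin 2 → ℝ) ∈ C.deformations P ν := by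
    refine ⟨fun x y hxy => ?_, fun i hi => hsingle _ ?_, fun i hi => ?_⟩
    · by_cases hx : x = v
      · subst hx; exact hbend y hxy
      by_cases hy : y = v
      · subst hy; rw [← C.bend_swap hxy]; exact hbend x hxy.symm
      · exact bend_eq_zero_of_eq (by rw [hsingle x hx, hsingle y hy])
    · rintro rfl
      rw [h.mem_deformations.2.1 i hi] at hv
      exact lt_irrefl _ hv
    · by_cases hiv : C.mark i = v
      · have hnormal := h.mem_deformations.2.2 i hi
        rw [dotProduct, Fin.sum_univ_two, h.mark_apply_one_eq_zero hi (hiv ▸ hv), mul_zero,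
          add_zero] at hnormal
        rw [hiv, Pi.single_eq_same, dotProduct, Fin.sum_univ_two,
          (mul_eq_zero.mp hnormal).resolve_right (hiv ▸ hv.ne)]
        simp
      · rw [hsingle _ hiv, dotProduct_zero]
  obtain ⟨c, hc⟩ := Submodule.mem_span_singleton.mp (h.deformations_le hmem)
  have hc0 : c ≠ 0 := by
    rintro rfl
    simpa using congrFun (congrFun hc v) 0
  exact (smul_eq_zero.mp ((congrFun hc w).trans (hsingle w hw))).resolve_left hc0

end IsUnboundedDeformation

theorem isMovingLeaf_of_card_boundary_eq_one {v : C.V} (hsupport : ∀ w ≠ v, D w = 0)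
    (hboundary : (boundary C.graph {v}).card = 1) : C.IsMovingLeaf D v := by
  refine ⟨hsupport, fun w w' hw hw' => ?_⟩
  have hmem : ∀ x, C.graph.Adj v x → (v, x) ∈ boundary C.graph {v} := fun x hx =>
    mem_boundary.mpr ⟨Finset.mem_singleton_self v, Finset.notMem_singleton.mpr hx.ne', hx⟩
  exact (Prod.mk.inj (Finset.card_le_one.mp hboundary.le _ (hmem w hw) _ (hmem w' hw'))).2

namespace IsUnboundedDeformation

/-- The flags that leave `S` point to the right, so that by balancing the unbounded edges at `S`
point to the left on the whole. -/
theorem exists_card_endsIn_eq (h : C.IsUnboundedDeformation P ν D ℓ) (hC : C.IsTrivalent)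
    (hends : ∀ u, IsStandardDir (C.endDir u)) (hS : C.IsLeftmost D S) :
    ∃ p q : ℕ, (C.endsIn S).card = p + q ∧ (boundary C.graph S).card ≤ p ∧
      ∑ x ∈ boundary C.graph S, C.dir x.1 x.2 1 = q ∧
      ∀ u ∈ C.endsIn S, C.endDir u 1 = 0 ∨ C.endDir u 1 = -1 ∧ 0 < q := by
  obtain ⟨p, q, s, hmap, hcard, hsum0, hsum1⟩ := exists_map_endDir_endsIn hends S
  have hbalance0 := C.sum_boundary_dir_apply_add_sum_endDir_apply S 0
  have hbalance1 := C.sum_boundary_dir_apply_add_sum_endDir_apply S 1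
  have hboundary : ((boundary C.graph S).card : ℤ) ≤ ∑ x ∈ boundary C.graph S, C.dir x.1 x.2 0 := by
    simpa using Finset.card_nsmul_le_sum _ _ 1 fun x hx => h.one_le_dir_of_mem_boundary hS hx
  have hpos := h.card_boundary_pos hS
  have htwo := h.card_endsIn_le_two hC hS
  obtain rfl : s = 0 := by omega
  refine ⟨p, q, by omega, by omega, by omega, fun u hu => ?_⟩
  have hmem : C.endDir u ∈ (C.endsIn S).val.map C.endDir := Multiset.mem_map_of_mem _ hu
  simp only [hmap, Multiset.mem_add, Multiset.mem_replicate, ne_eq] at hmem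
  rcases hmem with (⟨-, he⟩ | ⟨hq, he⟩) | ⟨hs, -⟩
  · exact Or.inl (by rw [he]; rfl)
  · exact Or.inr ⟨by rw [he]; rfl, Nat.pos_of_ne_zero hq⟩
  · exact absurd trivial hs

theorem exists_isMovingLeaf_of_horizontal (h : C.IsUnboundedDeformation P ν D ℓ)
    (hC : C.IsTrivalent) (hends : ∀ u, IsStandardDir (C.endDir u)) (hS : C.IsLeftmost D S)
    (hboundary : ∀ p ∈ boundary C.graph S, C.dir p.1 p.2 1 = 0)
    (hends1 : ∀ u ∈ C.endsIn S, C.endDir u 1 = 0) : ∃ v, C.IsMovingLeaf D v := by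
  obtain ⟨v, hv⟩ := hS.nonempty
  have hsupport : ∀ w ≠ v, D w = 0 := fun w hw =>
    h.eq_zero_of_forall_dir_eq_zero (hS.neg v hv)
      (fun x hx => dir_apply_eq_zero_of_boundary hboundary hends1 hv hx) hw
  obtain rfl : S = {v} := Finset.eq_singleton_iff_unique_mem.mpr ⟨hv, fun w hw => by
    by_contra hne
    have := hS.neg w hw
    rw [hsupport w hne] at this
    exact lt_irrefl _ this⟩
  obtain ⟨p, q, hcard, hle, -⟩ := h.exists_card_endsIn_eq hC hends hS
  have hcount := hC.card_add_two hS.isTree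
  have hpos := h.card_boundary_pos hS
  rw [Finset.card_singleton] at hcount
  exact ⟨v, isMovingLeaf_of_card_boundary_eq_one hsupport (by omega)⟩

theorem neg_apply_one_eq_of_mem_boundary (h : C.IsUnboundedDeformation P ν D ℓ)
    (hsupport : ∀ v ∉ S, D v = 0) {p : C.V × C.V} (hp : p ∈ boundary C.graph S) :
    -D p.1 1 = ℓ s(p.1, p.2) * (C.dir p.1 p.2 1 : ℝ) := by
  obtain ⟨-, hp2, hadj⟩ := mem_boundary.mp hp
  rw [← h.sub_apply hadj 1, hsupport _ hp2, Pi.zero_apply, zero_sub]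

theorem dir_apply_neg_of_lt (h : C.IsUnboundedDeformation P ν D ℓ) {v w : C.V}
    (hvw : C.graph.Adj v w) {j : Fin 2} (hlt : D w j < D v j) : C.dir v w j < 0 := by
  have : (C.dir v w j : ℝ) < 0 := neg_of_mul_neg_right
    (by rw [← h.sub_apply hvw j]; exact sub_neg.mpr hlt) (h.len_nonneg v w hvw)
  exact_mod_cast this

theorem dir_apply_one_nonpos_of_mem_boundary (h : C.IsUnboundedDeformation P ν D ℓ)
    (hS : C.IsLeftmost D S) (hsupport : ∀ v ∉ S, D v = 0) {p : C.V × C.V}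
    (hp : p ∈ boundary C.graph S) (hup : 0 ≤ D p.1 1) : C.dir p.1 p.2 1 ≤ 0 := by
  have : (C.dir p.1 p.2 1 : ℝ) ≤ 0 := nonpos_of_mul_nonpos_right
    (by rw [← h.neg_apply_one_eq_of_mem_boundary hsupport hp]; exact neg_nonpos.mpr hup)
    (h.len_pos_of_mem_boundary hS hp)
  exact_mod_cast this

/-- Balancing on the topmost vertices of `S`: no flag that leaves them points upwards. -/
theorem horizontal_of_exists_apply_one_nonneg (h : C.IsUnboundedDeformation P ν D ℓ)
    (hS : C.IsLeftmost D S) (hsupport : ∀ v ∉ S, D v = 0)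
    (hends1 : ∀ u ∈ C.endsIn S, C.endDir u 1 ≤ 0) (hup : ∃ v ∈ S, 0 ≤ D v 1) :
    (∀ p ∈ boundary C.graph S, C.dir p.1 p.2 1 = 0) ∧ ∀ u ∈ C.endsIn S, C.endDir u 1 = 0 := by
  classical
  obtain ⟨v₁, hv₁, hv₁up⟩ := hup
  obtain ⟨v₀, hv₀, hmax⟩ := Finset.exists_max_image S (fun v => D v 1) ⟨v₁, hv₁⟩
  set top := S.filter fun v => D v 1 = D v₀ 1
  have htop : top ⊆ S := Finset.filter_subset _ _
  have hinner : ∀ p ∈ boundary C.graph top, p.2 ∈ S → C.dir p.1 p.2 1 < 0 := by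
    rintro ⟨v, w⟩ hp hw
    obtain ⟨hv, hwtop, hvw⟩ := mem_boundary.mp hp
    refine h.dir_apply_neg_of_lt hvw ?_
    rw [(Finset.mem_filter.mp hv).2]
    exact lt_of_le_of_ne (hmax w hw) fun heq => hwtop (Finset.mem_filter.mpr ⟨hw, heq⟩)
  have houter : ∀ p ∈ boundary C.graph top, C.dir p.1 p.2 1 ≤ 0 := by
    rintro ⟨v, w⟩ hp
    by_cases hw : w ∈ S
    · exact (hinner _ hp hw).le
    obtain ⟨hv, -, hvw⟩ := mem_boundary.mp hp
    refine h.dir_apply_one_nonpos_of_mem_boundary hS hsupport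
      (mem_boundary.mpr ⟨htop hv, hw, hvw⟩) ?_
    rw [(Finset.mem_filter.mp hv).2]
    exact hv₁up.trans (hmax v₁ hv₁)
  have hendsTop : ∀ u ∈ C.endsIn top, C.endDir u 1 ≤ 0 := fun u hu =>
    hends1 u (mem_endsIn.mpr (htop (mem_endsIn.mp hu)))
  have hbalance := C.sum_boundary_dir_apply_add_sum_endDir_apply top 1
  have hsum := Finset.sum_nonpos houter
  have hsumEnds := Finset.sum_nonpos hendsTop
  have hboundary0 := (Finset.sum_eq_zero_iff_of_nonpos houter).mp (by omega)
  have hends0 := (Finset.sum_eq_zero_iff_of_nonpos hendsTop).mp (by omega)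
  have htopS : (top : Set C.V) = S := eq_of_subset_of_forall_adj_mem
    hS.isTree.connected.preconnected (Finset.coe_subset.mpr htop)
    ⟨v₀, Finset.mem_filter.mpr ⟨hv₀, rfl⟩⟩ fun v hv w hw hvw => by
      by_contra hwtop
      have hp : (v, w) ∈ boundary C.graph top := mem_boundary.mpr ⟨hv, hwtop, hvw⟩
      exact (hinner _ hp hw).ne (hboundary0 _ hp)
  rw [Finset.coe_inj.mp htopS] at hboundary0 hends0
  exact ⟨hboundary0, hends0⟩

theorem exists_isMovingLeaf_of_forall_apply_one_neg (h : C.IsUnboundedDeformation P ν D ℓ)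
    (hC : C.IsTrivalent) (hends : ∀ u, IsStandardDir (C.endDir u)) (hS : C.IsLeftmost D S)
    (hsupport : ∀ v ∉ S, D v = 0) (hdown : ∀ v ∈ S, D v 1 < 0) : ∃ v, C.IsMovingLeaf D v := by
  have hdir : ∀ p ∈ boundary C.graph S, 1 ≤ C.dir p.1 p.2 1 := fun p hp => by
    have : (0 : ℝ) < C.dir p.1 p.2 1 := pos_of_mul_pos_right (by
      rw [← h.neg_apply_one_eq_of_mem_boundary hsupport hp]
      exact neg_pos.mpr (hdown _ (mem_boundary.mp hp).1)) (h.len_pos_of_mem_boundary hS hp).le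
    exact_mod_cast this
  have hboundary : ((boundary C.graph S).card : ℤ) ≤ ∑ x ∈ boundary C.graph S, C.dir x.1 x.2 1 := by
    simpa using Finset.card_nsmul_le_sum _ _ 1 hdir
  have hmarks : C.marksIn S = ∅ := Finset.eq_empty_of_forall_notMem fun i hi => by
    rw [mem_marksIn] at hi
    exact (hdown _ hi).ne
      (h.mark_apply_one_eq_zero (fun hP => h.mark_notMem hS i hP hi) (hS.neg _ hi))
  obtain ⟨p, q, hcard, hle, hsum, -⟩ := h.exists_card_endsIn_eq hC hends hS
  have hpos := h.card_boundary_pos hS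
  have htwo := h.card_endsIn_le_two hC hS
  have hcount := hC.card_add_two hS.isTree
  rw [hmarks, Finset.card_empty] at hcount
  obtain ⟨v, rfl⟩ := Finset.card_eq_one.mp (show S.card = 1 by omega)
  exact ⟨v, isMovingLeaf_of_card_boundary_eq_one
    (fun w hw => hsupport w (Finset.notMem_singleton.mpr hw)) (by omega)⟩

theorem exists_isMovingLeaf_of_neg (h : C.IsUnboundedDeformation P ν D ℓ)
    (hC : C.IsTrivalent) (hends : ∀ u, IsStandardDir (C.endDir u)) {v : C.V} (hv : D v 0 < 0) :
    ∃ v, C.IsMovingLeaf D v := by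
  obtain ⟨S, hS⟩ := exists_isLeftmost hv
  obtain ⟨p, q, hcard, hle, hsum, hends1⟩ := h.exists_card_endsIn_eq hC hends hS
  have hpos := h.card_boundary_pos hS
  have htwo := h.card_endsIn_le_two hC hS
  by_cases hone : (C.endsIn S).card = 1
  · obtain ⟨x, hx⟩ := Finset.card_eq_one.mp (show (boundary C.graph S).card = 1 by omega)
    obtain rfl : q = 0 := by omega
    rw [hx, Finset.sum_singleton] at hsum
    refine h.exists_isMovingLeaf_of_horizontal hC hends hS (fun y hy => ?_) fun u hu => ?_
    · rw [hx, Finset.mem_singleton] at hy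
      rw [hy, hsum, Nat.cast_zero]
    · exact (hends1 u hu).resolve_right fun hq => lt_irrefl _ hq.2
  · have hsupport := fun v => h.eq_zero_of_card_endsIn_eq_two hC hS (by omega) (v := v)
    by_cases hup : ∃ v ∈ S, 0 ≤ D v 1
    · obtain ⟨hboundary, hends0⟩ := h.horizontal_of_exists_apply_one_nonneg hS hsupport
        (fun u hu => by rcases hends1 u hu with he | ⟨he, -⟩ <;> omega) hup
      exact h.exists_isMovingLeaf_of_horizontal hC hends hS hboundary hends0
    · push Not at hup
      exact h.exists_isMovingLeaf_of_forall_apply_one_neg hC hends hS hsupport hup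

end IsUnboundedDeformation
end

end PlaneTropicalCurve

/-! ### The symmetries of the standard directions -/

open Matrix

/-- The real matrix with the entries of an integral matrix. -/
abbrev toReal (T : Matrix (Fin 2) (Fin 2) ℤ) : Matrix (Fin 2) (Fin 2) ℝ :=
  (Int.castRingHom ℝ).mapMatrix T

theorem cast_mulVec_apply (T : Matrix (Fin 2) (Fin 2) ℤ) (e : Fin 2 → ℤ) (j : Fin 2) :
    ((T *ᵥ e) j : ℝ) = (toReal T *ᵥ fun k => (e k : ℝ)) j :=
  (Int.castRingHom ℝ).map_mulVec T e j

namespace PlaneTropicalCurve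

variable {I : Type} [Fintype I]

/-- The image of a plane tropical curve under an integral linear map. -/
def transform (C : PlaneTropicalCurve I) (T : Matrix (Fin 2) (Fin 2) ℤ) :
    PlaneTropicalCurve I where
  V := C.V
  U := C.U
  graph := C.graph
  isTree := C.isTree
  len := C.len
  len_pos := C.len_pos
  mark := C.mark
  endAt := C.endAt
  endDir u := T *ᵥ C.endDir u
  pos v := toReal T *ᵥ C.pos v
  dir v w := T *ᵥ C.dir v w
  pos_sub v w hvw j := by
    have hpos : C.pos w - C.pos v = C.len s(v, w) • fun k => (C.dir v w k : ℝ) :=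
      funext (C.pos_sub v w hvw)
    rw [cast_mulVec_apply, ← Pi.sub_apply, ← mulVec_sub, hpos, mulVec_smul, Pi.smul_apply,
      smul_eq_mul]
  balanced v := by
    have h := congrArg T.mulVecLin (C.balanced v)
    simpa only [map_add, map_sum, map_zero, apply_ite T.mulVecLin, mulVecLin_apply] using h
  three_le_valence := C.three_le_valence

variable {C : PlaneTropicalCurve I} {P : I → Prop} {ν : I → Fin 2 → ℝ} {D : C.V → Fin 2 → ℝ}
  {ℓ : Sym2 C.V → ℝ} {T : Matrix (Fin 2) (Fin 2) ℤ}

theorem bend_transform (v w : C.V) : (C.transform T).bend v w (fun x : C.V => toReal T *ᵥ D x)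
    = (toReal T).det * C.bend v w D := by
  change ((T *ᵥ C.dir v w) 0 : ℝ) * ((toReal T *ᵥ D w) 1 - (toReal T *ᵥ D v) 1)
    - ((T *ᵥ C.dir v w) 1 : ℝ) * ((toReal T *ᵥ D w) 0 - (toReal T *ᵥ D v) 0) = _
  rw [cast_mulVec_apply, cast_mulVec_apply]
  simp only [bend_apply, det_fin_two, mulVec, dotProduct, Fin.sum_univ_two]
  ring

theorem mem_deformations_transform (hT : toReal T * toReal T = 1) :
    (fun x : C.V => toReal T *ᵥ D x) ∈ (C.transform T).deformations P (fun i => ν i ᵥ* toReal T) ↔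
      D ∈ C.deformations P ν := by
  have hdet : (toReal T).det ≠ 0 := left_ne_zero_of_mul_eq_one
    (b := (toReal T).det) (by rw [← det_mul, hT, det_one])
  refine and_congr ?_ (and_congr ?_ ?_)
  · exact forall₃_congr fun v w _ => (Eq.congr_left (bend_transform (C := C) v w)).trans
      (mul_eq_zero.trans (or_iff_right hdet))
  · refine forall₂_congr fun i _ => ⟨fun h => ?_, fun h => ?_⟩
    · exact eq_zero_of_mulVec_eq_zero hdet h
    · exact (congrArg (toReal T *ᵥ ·) h).trans (mulVec_zero _)
  · refine forall₂_congr fun i _ => ?_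
    exact Eq.congr_left ((dotProduct_mulVec ..).trans (by rw [vecMul_vecMul, hT, vecMul_one]; rfl))

theorem IsUnboundedDeformation.transform (h : C.IsUnboundedDeformation P ν D ℓ)
    (hT : toReal T * toReal T = 1) (hstandard : ∀ e, IsStandardDir e → IsStandardDir (T *ᵥ e)) :
    (C.transform T).IsUnboundedDeformation P (fun i => ν i ᵥ* toReal T)
      (fun x : C.V => toReal T *ᵥ D x) ℓ where
  mem_variations v w hvw j := by
    have hsub : D w - D v = ℓ s(v, w) • fun k => (C.dir v w k : ℝ) := funext (h.sub_apply hvw)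
    change (toReal T *ᵥ D w) j - (toReal T *ᵥ D v) j = ℓ s(v, w) * ((T *ᵥ C.dir v w) j : ℝ)
    rw [cast_mulVec_apply, ← Pi.sub_apply, ← mulVec_sub, hsub, mulVec_smul, Pi.smul_apply,
      smul_eq_mul]
  len_nonneg := h.len_nonneg
  mem_deformations := (mem_deformations_transform hT).mpr h.mem_deformations
  deformations_le D' hD' := by
    have hinv : (fun x : C.V => toReal T *ᵥ toReal T *ᵥ D' x) = D' := funext fun x => by
      rw [mulVec_mulVec, hT, one_mulVec]
    have hpre : (fun x : C.V => toReal T *ᵥ D' x) ∈ C.deformations P ν :=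
      (mem_deformations_transform hT).mp (hinv.symm ▸ hD')
    obtain ⟨c, hc⟩ := Submodule.mem_span_singleton.mp (h.deformations_le hpre)
    refine Submodule.mem_span_singleton.mpr ⟨c, ?_⟩
    rw [← hinv]
    funext x
    rw [← congrFun hc x]
    exact (mulVec_smul (toReal T) c (D x)).symm
  exists_fixed := h.exists_fixed
  recession i hi := by
    obtain ⟨s, hs, e, he, hD⟩ := h.recession i hi
    refine ⟨s, hs, T *ᵥ e, hstandard e he, ?_⟩
    change toReal T *ᵥ D (C.mark i) = _
    rw [hD, mulVec_smul]
    exact congrArg (s • ·) (funext fun j => (cast_mulVec_apply T e j).symm)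

theorem IsMovingLeaf.of_transform (hT : toReal T * toReal T = 1) {v : C.V}
    (h : (C.transform T).IsMovingLeaf (fun x : C.V => toReal T *ᵥ D x) v) : C.IsMovingLeaf D v :=
  ⟨fun w hw => by
    rw [← one_mulVec (D w), ← hT, ← mulVec_mulVec]
    exact (congrArg (toReal T *ᵥ ·) (h.1 w hw)).trans (mulVec_zero _), h.2⟩

theorem IsUnboundedDeformation.exists_isMovingLeaf_of_mulVec_neg
    (h : C.IsUnboundedDeformation P ν D ℓ) (hC : C.IsTrivalent)
    (hends : ∀ u, IsStandardDir (C.endDir u)) (hT : T * T = 1)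
    (hstandard : ∀ e, IsStandardDir e → IsStandardDir (T *ᵥ e)) {v : C.V}
    (hneg : (toReal T *ᵥ D v) 0 < 0) : ∃ v, C.IsMovingLeaf D v := by
  have hTreal : toReal T * toReal T = 1 := by rw [← map_mul, hT, map_one]
  obtain ⟨v, hv⟩ := (h.transform hTreal hstandard).exists_isMovingLeaf_of_neg
    (C := C.transform T) hC (fun u => hstandard _ (hends u)) hneg
  exact ⟨v, hv.of_transform hTreal⟩

theorem IsUnboundedDeformation.exists_isMovingLeaf (h : C.IsUnboundedDeformation P ν D ℓ)
    (hC : C.IsTrivalent) (hends : ∀ u, IsStandardDir (C.endDir u)) (hD : D ≠ 0) :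
    ∃ v, C.IsMovingLeaf D v := by
  by_contra hleaf
  have hnonneg : ∀ T : Matrix (Fin 2) (Fin 2) ℤ, T * T = 1 →
      (∀ e, IsStandardDir e → IsStandardDir (T *ᵥ e)) → ∀ v, 0 ≤ (toReal T *ᵥ D v) 0 :=
    fun T hT hstandard v => not_lt.mp fun hneg =>
      hleaf (h.exists_isMovingLeaf_of_mulVec_neg hC hends hT hstandard hneg)
  have hleft : ∀ v, 0 ≤ D v 0 := by
    simpa using hnonneg 1 (by decide) (fun e he => by rwa [one_mulVec])
  have hdown : ∀ v, 0 ≤ D v 1 := by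
    simpa using hnonneg !![0, 1; 1, 0] (by decide) (by
      rintro e (rfl | rfl | rfl) <;> unfold IsStandardDir <;> decide)
  have hright : ∀ v, 0 ≤ -D v 0 := by
    simpa using hnonneg !![-1, 0; -1, 1] (by decide) (by
      rintro e (rfl | rfl | rfl) <;> unfold IsStandardDir <;> decide)
  have hup : ∀ v, 0 ≤ D v 0 - D v 1 := by
    simpa [sub_eq_add_neg] using hnonneg !![1, -1; 0, -1] (by decide) (by
      rintro e (rfl | rfl | rfl) <;> unfold IsStandardDir <;> decide)
  refine hD (funext fun v => funext fun j => ?_)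
  have hzero : D v 0 = 0 := by linarith [hleft v, hright v]
  fin_cases j
  · exact hzero
  · exact le_antisymm (by simpa [hzero] using hup v) (hdown v)

end PlaneTropicalCurve

/-! ### Contracted bounded edges -/

namespace PlaneTropicalCurve

variable {I : Type} [Fintype I] {C : PlaneTropicalCurve I}

theorem IsTrivalent.card_boundary_singleton (hC : C.IsTrivalent) (v : C.V) :
    (boundary C.graph {v}).card + (C.endsIn {v}).card + (C.marksIn {v}).card = 3 := by
  have htree : (C.graph.induce (({v} : Finset C.V) : Set C.V)).IsTree := by
    rw [Finset.coe_singleton]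
    exact .of_subsingleton
  rw [← hC.card_add_two htree, Finset.card_singleton]

/-- The flags at `v` other than those to `T` are markings, which have direction zero. -/
theorem IsTrivalent.sum_dir_eq_zero (hC : C.IsTrivalent) {v : C.V} {T : Finset C.V}
    (hT : ∀ w ∈ T, C.graph.Adj v w) (hcard : 3 ≤ T.card + (C.marksIn {v}).card) :
    ∑ w ∈ T, C.dir v w = 0 := by
  set flags := T.map (.sectR v C.V) with hflags
  have hsubset : flags ⊆ boundary C.graph {v} := by
    intro p hp
    obtain ⟨w, hw, rfl⟩ := Finset.mem_map.mp hp
    exact mem_boundary.mpr ⟨Finset.mem_singleton_self v,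
      fun h => (hT w hw).ne (Finset.mem_singleton.mp h).symm, hT w hw⟩
  have hvalence := hC.card_boundary_singleton v
  have hle := Finset.card_le_card hsubset
  rw [hflags, Finset.card_map] at hle
  have heq : flags = boundary C.graph {v} := Finset.eq_of_subset_of_card_le hsubset (by
    rw [hflags, Finset.card_map]
    omega)
  have hends : C.endsIn {v} = ∅ := Finset.card_eq_zero.mp (by omega)
  have hbalanced := C.sum_boundary_dir_add_sum_endDir {v}
  rw [hends, Finset.sum_empty, add_zero, ← heq, hflags, Finset.sum_map] at hbalanced
  exact hbalanced

namespace ContractedEdge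

variable {E : C.ContractedEdge}

variable (E) in
/-- The vertices on the side of `E.fst`, as a finite set. -/
noncomputable def sideFinset : Finset C.V := edgeSide C.graph E.fst E.snd

theorem mem_sideFinset {v : C.V} : v ∈ E.sideFinset ↔ v ∈ E.side := mem_edgeSide

theorem fst_mem_sideFinset : E.fst ∈ E.sideFinset := mem_sideFinset.mpr E.fst_mem

theorem snd_notMem_sideFinset : E.snd ∉ E.sideFinset := mem_sideFinset.not.mpr E.snd_notMem

theorem coe_sideFinset : (E.sideFinset : Set C.V) = E.side := Set.ext fun _ => mem_sideFinset

variable (E) in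
theorem isTree_sideFinset : (C.graph.induce (E.sideFinset : Set C.V)).IsTree := by
  rw [coe_sideFinset]
  exact E.isTree_induce

variable (E) in
theorem boundary_sideFinset : boundary C.graph E.sideFinset = {(E.fst, E.snd)} :=
  boundary_edgeSide C.isAcyclic E.adj

theorem mem_symm_side {v : C.V} : v ∈ E.symm.side ↔ v ∉ E.side := by
  have hside : v ∈ E.symm.side ↔ (C.graph.deleteEdges {s(E.fst, E.snd)}).Reachable E.snd v := by
    rw [Sym2.eq_swap]
    rfl
  rw [hside]
  exact ⟨fun hsnd hfst => E.snd_notMem (hfst.trans hsnd.symm),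
    (reachable_deleteEdges_or C.preconnected E.fst E.snd v).resolve_left⟩

variable (E) in
/-- `E` is the only contracted bounded edge. -/
def IsUnique : Prop := ∀ E' : C.ContractedEdge, s(E'.fst, E'.snd) = s(E.fst, E.snd)

theorem IsUnique.symm (hE : E.IsUnique) : E.symm.IsUnique :=
  fun E' => (hE E').trans Sym2.eq_swap

theorem IsUnique.eq_snd (hE : E.IsUnique) {w : C.V} (hw : C.graph.Adj E.fst w)
    (hdir : C.dir E.fst w = 0) : w = E.snd :=
  Sym2.congr_right.mp (hE ⟨E.fst, w, hw, hdir⟩)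

variable (E) in
theorem exists_forall_dir_snd_eq_smul (hC : C.IsTrivalent) : ∃ u : Fin 2 → ℤ,
    ∀ w, C.graph.Adj E.snd w → w ≠ E.fst → ∃ c : ℤ, C.dir E.snd w = c • u := by
  classical
  by_cases hw₁ : ∃ w₁, C.graph.Adj E.snd w₁ ∧ w₁ ≠ E.fst
  swap
  · exact ⟨0, fun w hw hne => absurd ⟨w, hw, hne⟩ hw₁⟩
  obtain ⟨w₁, hw₁, hne₁⟩ := hw₁
  refine ⟨C.dir E.snd w₁, fun w hw hne => ?_⟩
  obtain rfl | hne' := eq_or_ne w w₁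
  · exact ⟨1, (one_smul ℤ _).symm⟩
  have hcard : ({E.fst, w₁, w} : Finset C.V).card = 3 :=
    Finset.card_eq_three.mpr ⟨_, _, _, hne₁.symm, hne.symm, hne'.symm, rfl⟩
  have hsum := hC.sum_dir_eq_zero (v := E.snd) (T := {E.fst, w₁, w})
    (by simp [E.adj.symm, hw₁, hw]) (by omega)
  have hback : C.dir E.snd E.fst = 0 := E.symm.dir_eq_zero
  rw [Finset.sum_insert (by simp [hne₁.symm, hne.symm]), Finset.sum_pair hne'.symm, hback,
    zero_add] at hsum
  exact ⟨-1, by rw [neg_one_smul, eq_neg_of_add_eq_zero_right hsum]⟩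

open Classical in
/-- The far end of the contracted edge moves along with the near end; it is free to do so in the
common direction of the other flags at it. -/
theorem bend_update_eq_zero {D : C.V → Fin 2 → ℝ} {u : Fin 2 → ℤ}
    (hu : ∀ w, C.graph.Adj E.snd w → w ≠ E.fst → ∃ c : ℤ, C.dir E.snd w = c • u)
    (hsupport : ∀ v ∉ E.sideFinset, D v = 0)
    (hbend : ∀ v ∈ E.sideFinset, ∀ w ∈ E.sideFinset, C.graph.Adj v w → C.bend v w D = 0)
    (hparallel : u 0 * D E.fst 1 - u 1 * D E.fst 0 = 0) {v w : C.V} (hvw : C.graph.Adj v w) :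
    C.bend v w (Function.update D E.snd (D E.fst)) = 0 := by
  set D' := Function.update D E.snd (D E.fst)
  have hD' {x : C.V} (hx : x ≠ E.snd) : D' x = D x := Function.update_of_ne hx _ _
  have hsnd : D' E.snd = D E.fst := Function.update_self ..
  have hat_snd {x : C.V} (hx : C.graph.Adj E.snd x) : C.bend E.snd x D' = 0 := by
    obtain rfl | hfst := eq_or_ne x E.fst
    · exact bend_eq_zero_of_eq (by rw [hsnd, hD' E.adj.ne])
    · obtain ⟨c, hc⟩ := hu x hx hfst
      have hx' : D x = 0 := hsupport x fun hmem =>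
        hfst (E.eq_of_adj (mem_sideFinset.mp hmem) E.snd_notMem hx.symm).1
      simp only [bend_apply, hc, hsnd, hD' hx.ne', hx', Pi.smul_apply, Pi.zero_apply, smul_eq_mul,
        Int.cast_mul]
      linear_combination -(c : ℝ) * hparallel
  obtain rfl | hv := eq_or_ne v E.snd
  · exact hat_snd hvw
  obtain rfl | hw := eq_or_ne w E.snd
  · rw [← C.bend_swap hvw, hat_snd hvw.symm]
  rw [bend_apply, hD' hv, hD' hw, ← bend_apply]
  have hcross {x y : C.V} (hy : y ≠ E.snd) (hxy : C.graph.Adj x y) (hx : x ∈ E.sideFinset) :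
      y ∈ E.sideFinset := by
    by_contra hmem
    exact hy (E.eq_of_adj (mem_sideFinset.mp hx) (mem_sideFinset.not.mp hmem) hxy).2
  by_cases hvS : v ∈ E.sideFinset
  · exact hbend v hvS w (hcross hw hvw hvS) hvw
  · exact bend_eq_zero_of_eq (by
      rw [hsupport v hvS, hsupport w fun hwS => hvS (hcross hv hvw.symm hwS)])

open Classical in
/-- Otherwise the conditions on the side of `E.fst` would leave a deformation of this side which
extends to `C`. -/
theorem card_endsIn_sideFinset_le {P : I → Prop} {ν : I → Fin 2 → ℝ} (hC : C.IsTrivalent)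
    (hrigid : ∀ D ∈ C.deformations P ν, D E.fst = D E.snd → D = 0)
    (hmark : ∀ i, C.mark i ≠ E.snd) :
    (C.endsIn E.sideFinset).card ≤ ((C.marksIn E.sideFinset).filter P).card + 1 := by
  by_contra! hlt
  obtain ⟨u, hu⟩ := E.exists_forall_dir_snd_eq_smul hC
  have hcard := hC.card_add_two E.isTree_sideFinset
  rw [boundary_sideFinset, Finset.card_singleton,
    ← Finset.card_filter_add_card_filter_not (s := C.marksIn E.sideFinset) P] at hcard
  obtain ⟨D, hD0, hsupport, hbend, hD⟩ := exists_displacement_of_isTree E.isTree_sideFinset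
    (J := ((C.marksIn E.sideFinset).filter P × Fin 2) ⊕
      ((C.marksIn E.sideFinset).filter fun i => ¬ P i) ⊕ Unit)
    (Sum.elim (fun x => LinearMap.proj x.2 ∘ₗ LinearMap.proj (C.mark x.1))
      (Sum.elim (fun i => C.normalVelocity (ν i) i)
        fun _ => ((u 0 : ℝ) • LinearMap.proj (1 : Fin 2) - (u 1 : ℝ) • LinearMap.proj (0 : Fin 2))
          ∘ₗ LinearMap.proj E.fst)) (by
    simp only [Fintype.card_sum, Fintype.card_coe, Fintype.card_fin, Fintype.card_prod,
      Fintype.card_unit]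
    omega)
  set D' := Function.update D E.snd (D E.fst)
  have hD' {x : C.V} (hx : x ≠ E.snd) : D' x = D x := Function.update_of_ne hx _ _
  have hmem : D' ∈ C.deformations P ν := by
    refine mem_deformations.mpr
      ⟨fun v w => bend_update_eq_zero hu hsupport hbend (hD (.inr (.inr ()))),
        fun i hi => ?_, fun i hi => ?_⟩ <;>
      rw [hD' (hmark i)] <;> by_cases hside : C.mark i ∈ E.sideFinset
    · exact funext fun j =>
        hD (.inl (⟨i, Finset.mem_filter.mpr ⟨mem_marksIn.mpr hside, hi⟩⟩, j))
    · exact hsupport _ hside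
    · exact hD (.inr (.inl ⟨i, Finset.mem_filter.mpr ⟨mem_marksIn.mpr hside, hi⟩⟩))
    · rw [hsupport _ hside, dotProduct_zero]
  have hzero : D' = 0 := hrigid D' hmem (by rw [hD' E.adj.ne]; simp only [D', Function.update_self])
  refine hD0 (funext fun v => ?_)
  obtain rfl | hv := eq_or_ne v E.snd
  · exact hsupport _ snd_notMem_sideFinset
  · rw [← hD' hv, hzero]

theorem side_eq_singleton_of_forall_not_adj (h : ∀ w ∈ E.side, ¬ C.graph.Adj E.fst w) :
    E.side = {E.fst} :=
  (eq_of_subset_of_forall_adj_mem E.isTree_induce.connected.preconnected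
    (Set.singleton_subset_iff.mpr E.fst_mem) (Set.singleton_nonempty _)
    fun _ hv w hw hvw => absurd (Set.mem_singleton_iff.mp hv ▸ hvw) (h w hw)).symm

theorem IsUnique.side_eq_singleton_of_mark_eq (hE : E.IsUnique) (hC : C.IsTrivalent) {i : I}
    (hi : C.mark i = E.fst) : E.side = {E.fst} := by
  classical
  refine side_eq_singleton_of_forall_not_adj fun w hw hadj => ?_
  have hne : E.snd ≠ w := fun h => E.snd_notMem (h ▸ hw)
  have hmark : 0 < (C.marksIn {E.fst}).card :=
    Finset.card_pos.mpr ⟨i, mem_marksIn.mpr (Finset.mem_singleton.mpr hi)⟩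
  have hsum := hC.sum_dir_eq_zero (v := E.fst) (T := {E.snd, w}) (by simp [E.adj, hadj]) (by
    rw [Finset.card_pair hne]
    omega)
  rw [Finset.sum_pair hne, E.dir_eq_zero, zero_add] at hsum
  exact hne (hE.eq_snd hadj hsum).symm

theorem IsUnique.side_eq_singleton_of_endsIn_eq_empty (hE : E.IsUnique)
    (h : C.endsIn E.sideFinset = ∅) : E.side = {E.fst} := by
  refine side_eq_singleton_of_forall_not_adj fun w hw hadj => ?_
  have hdir : C.dir E.fst w = 0 := funext fun j =>
    dir_apply_eq_zero_of_boundary (S := E.sideFinset)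
      (by simp [boundary_sideFinset, E.dir_eq_zero]) (by simp [h]) fst_mem_sideFinset hadj
  exact E.snd_notMem (hE.eq_snd hadj hdir ▸ hw)

open Classical in
variable (E) in
theorem exists_degree_component_eq (hends : ∀ u, IsStandardDir (C.endDir u)) :
    ∃ m : ℕ, E.component.degree = standardDegree m ∧ (C.endsIn E.sideFinset).card = 3 * m := by
  obtain ⟨p, q, s, hmap, hcard, hsum₀, hsum₁⟩ := exists_map_endDir_endsIn hends E.sideFinset
  have hbalance (j : Fin 2) : ∑ u ∈ C.endsIn E.sideFinset, C.endDir u j = 0 := by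
    simpa [boundary_sideFinset, E.dir_eq_zero]
      using C.sum_boundary_dir_apply_add_sum_endDir_apply E.sideFinset j
  rw [hbalance] at hsum₀ hsum₁
  obtain rfl : p = s := by omega
  obtain rfl : q = p := by omega
  refine ⟨q, ?_, by omega⟩
  have hsubtype : C.endsIn E.sideFinset
      = (Finset.univ : Finset {u // C.endAt u ∈ E.side}).map (Function.Embedding.subtype _) := by
    ext u
    simp [mem_endsIn, mem_sideFinset]
  rw [standardDegree, ← hmap, hsubtype, Finset.map_val, Multiset.map_map]
  unfold degree
  congr!

end ContractedEdge

end PlaneTropicalCurve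

/-! ### Rigidity -/

namespace PlaneTropicalCurve

variable {I : Type} [Fintype I] {C : PlaneTropicalCurve I}

/-- The four-point condition. -/
theorem Separates.not_separates {e f : Sym2 C.V} {i j k m : I} (he : C.Separates e i j k m) :
    ¬ C.Separates f i k j m := by
  rintro ⟨hik, hjm, hij⟩
  have hz : (Quot.out f).1 ∈ f := Sym2.out_fst_mem f
  refine he.2.2 ((reachable_deleteEdges_of_mem hij he.1 hz).trans
    (reachable_deleteEdges_of_mem (fun hkm => hij ?_) he.2.1 hz).symm)
  exact hik.trans (hkm.trans hjm.symm)

theorem Separates.swap {e : Sym2 C.V} {i j k m : I} (h : C.Separates e i j k m) :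
    C.Separates e i j m k :=
  ⟨h.1, h.2.1.symm, fun him => h.2.2 (him.trans h.2.1.symm)⟩

variable (C) in
open Classical in
/-- The rate of change of `separatingLength`, as a linear functional on the changes of the lengths
of the bounded edges. -/
noncomputable def separatingRate (i j k m : I) : Module.Dual ℝ (Sym2 C.V → ℝ) :=
  ∑ e : C.graph.edgeSet, if C.Separates e i j k m then LinearMap.proj e.1 else 0

open Classical in
theorem separatingRate_apply (i j k m : I) (ℓ : Sym2 C.V → ℝ) : C.separatingRate i j k m ℓ
    = ∑ e : C.graph.edgeSet, if C.Separates e i j k m then ℓ e else 0 := by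
  rw [separatingRate, LinearMap.sum_apply]
  refine Finset.sum_congr rfl fun e _ => ?_
  split_ifs <;> rfl

theorem separatingRate_len (i j k m : I) :
    C.separatingRate i j k m C.len = C.separatingLength i j k m :=
  separatingRate_apply i j k m C.len

/-- There is no variation of `C` other than zero which satisfies the conditions of `deformations`
and does not change `Λ`. -/
def IsRigid (C : PlaneTropicalCurve I) (P : I → Prop) (ν : I → Fin 2 → ℝ)
    (Λ : Module.Dual ℝ (Sym2 C.V → ℝ)) : Prop :=
  ∀ D ℓ, (D, ℓ) ∈ C.variations → D ∈ C.deformations P ν → Λ ℓ = 0 →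
    D = 0 ∧ ∀ e ∈ C.graph.edgeSet, ℓ e = 0

open Classical in
/-- The variation which changes the length of a contracted bounded edge and nothing else. -/
noncomputable def ContractedEdge.stretch (E : C.ContractedEdge) : Sym2 C.V → ℝ :=
  fun e => if e = s(E.fst, E.snd) then 1 else 0

theorem ContractedEdge.stretch_self (E : C.ContractedEdge) : E.stretch s(E.fst, E.snd) = 1 :=
  if_pos rfl

theorem ContractedEdge.stretch_of_ne (E : C.ContractedEdge) {e : Sym2 C.V}
    (he : e ≠ s(E.fst, E.snd)) : E.stretch e = 0 :=
  if_neg he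

theorem ContractedEdge.stretch_mem_variations (E : C.ContractedEdge) :
    ((0 : C.V → Fin 2 → ℝ), E.stretch) ∈ C.variations := by
  intro v w _ j
  simp only [Pi.zero_apply, sub_self]
  by_cases hedge : s(v, w) = s(E.fst, E.snd)
  · have hdir : C.dir v w = 0 := by
      obtain ⟨rfl, rfl⟩ | ⟨rfl, rfl⟩ := Sym2.eq_iff.mp hedge
      · exact E.dir_eq_zero
      · exact E.symm.dir_eq_zero
    simp [hdir]
  · rw [E.stretch_of_ne hedge, zero_mul]

namespace IsRigid

variable {P : I → Prop} {ν : I → Fin 2 → ℝ} {Λ : Module.Dual ℝ (Sym2 C.V → ℝ)}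
  {D : C.V → Fin 2 → ℝ} {ℓ : Sym2 C.V → ℝ}

theorem apply_stretch_ne_zero (h : C.IsRigid P ν Λ) (E : C.ContractedEdge) : Λ E.stretch ≠ 0 := by
  intro hzero
  have hlen := (h _ _ E.stretch_mem_variations (zero_mem _) hzero).2 s(E.fst, E.snd) E.adj
  rw [E.stretch_self] at hlen
  exact one_ne_zero hlen

theorem isUnique (h : C.IsRigid P ν Λ) (E : C.ContractedEdge) : E.IsUnique := by
  intro E'
  by_contra hne
  have hmem := C.variations.sub_mem (C.variations.smul_mem (Λ E.stretch) E'.stretch_mem_variations)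
    (C.variations.smul_mem (Λ E'.stretch) E.stretch_mem_variations)
  have hlen := (h _ _ hmem (by simp) (by simp [mul_comm])).2 s(E'.fst, E'.snd) E'.adj
  simp only [Prod.smul_snd, Pi.sub_apply, Pi.smul_apply, E'.stretch_self,
    E.stretch_of_ne hne, smul_eq_mul, mul_one, mul_zero, sub_zero] at hlen
  exact h.apply_stretch_ne_zero E hlen

theorem eq_zero_of_eq (h : C.IsRigid P ν Λ) (E : C.ContractedEdge) (hD : D ∈ C.deformations P ν)
    (heq : D E.fst = D E.snd) : D = 0 := by
  obtain ⟨ℓ, hℓ⟩ := exists_mem_variations (mem_deformations.mp hD).1 fun v w hvw hdir => by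
    obtain ⟨rfl, rfl⟩ | ⟨rfl, rfl⟩ := Sym2.eq_iff.mp (h.isUnique E ⟨v, w, hvw, hdir⟩)
    · exact heq
    · exact heq.symm
  have hmem := C.variations.sub_mem hℓ
    (C.variations.smul_mem (Λ ℓ / Λ E.stretch) E.stretch_mem_variations)
  rw [Prod.smul_mk, smul_zero, Prod.mk_sub_mk, sub_zero] at hmem
  refine (h _ _ hmem hD ?_).1
  rw [map_sub, map_smul, smul_eq_mul, div_mul_cancel₀ _ (h.apply_stretch_ne_zero E), sub_self]

theorem eq_smul (h : C.IsRigid P ν Λ) (hmem : (D, ℓ) ∈ C.variations)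
    (hD : D ∈ C.deformations P ν) (hrate : Λ ℓ ≠ 0) {D' : C.V → Fin 2 → ℝ} {ℓ' : Sym2 C.V → ℝ}
    (hmem' : (D', ℓ') ∈ C.variations) (hD' : D' ∈ C.deformations P ν) :
    D' = (Λ ℓ' / Λ ℓ) • D ∧ ∀ e ∈ C.graph.edgeSet, ℓ' e = Λ ℓ' / Λ ℓ * ℓ e := by
  have hsub := C.variations.sub_mem hmem' (C.variations.smul_mem (Λ ℓ' / Λ ℓ) hmem)
  obtain ⟨hdisplacement, hlen⟩ := h _ _ hsub (sub_mem hD' (Submodule.smul_mem _ _ hD)) (by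
    simp only [Prod.smul_snd, map_sub, map_smul, smul_eq_mul, div_mul_cancel₀ _ hrate, sub_self])
  exact ⟨sub_eq_zero.mp hdisplacement, fun e he => sub_eq_zero.mp (hlen e he)⟩

theorem deformations_le_span (h : C.IsRigid P ν Λ)
    (hcontracted : ∀ v w, C.graph.Adj v w → C.dir v w ≠ 0) (hmem : (D, ℓ) ∈ C.variations)
    (hD : D ∈ C.deformations P ν) (hrate : Λ ℓ ≠ 0) : C.deformations P ν ≤ ℝ ∙ D := by
  intro D' hD'
  obtain ⟨ℓ', hℓ'⟩ := exists_mem_variations (mem_deformations.mp hD').1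
    fun v w hvw hdir => absurd hdir (hcontracted v w hvw)
  exact Submodule.mem_span_singleton.mpr ⟨_, (h.eq_smul hmem hD hrate hℓ' hD').1.symm⟩

end IsRigid

theorem IsRigid.separates {P : I → Prop} {ν : I → Fin 2 → ℝ} {i j k m : I}
    (h : C.IsRigid P ν (C.separatingRate i j k m)) (E : C.ContractedEdge) :
    C.Separates s(E.fst, E.snd) i j k m := by
  classical
  by_contra hsep
  refine h.apply_stretch_ne_zero E ?_
  rw [separatingRate_apply]
  refine Finset.sum_eq_zero fun e _ => ?_
  split_ifs with he
  · exact E.stretch_of_ne fun heq => hsep (heq ▸ he)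
  · rfl

/-- The sum telescopes. -/
theorem sum_darts_eq_sub {D : C.V → Fin 2 → ℝ} {ℓ : Sym2 C.V → ℝ} (h : (D, ℓ) ∈ C.variations)
    {v w : C.V} (p : C.graph.Walk v w) (j : Fin 2) :
    (p.darts.map fun d => (C.dir d.fst d.snd j : ℝ) * ℓ d.edge).sum = D w j - D v j := by
  induction p with
  | nil => simp
  | cons hvw p ih =>
    rw [SimpleGraph.Walk.darts_cons, List.map_cons, List.sum_cons, ih, SimpleGraph.Dart.edge_mk,
      mul_comm, ← h _ _ hvw j]
    ring

end PlaneTropicalCurve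

open Classical in
theorem sum_sum_filter_edge_mul {V : Type*} {G : SimpleGraph V} [Fintype G.edgeSet]
    (L : List G.Dart) (f : G.Dart → ℝ) (ℓ : Sym2 V → ℝ) :
    ∑ e : G.edgeSet, ((L.filter fun d => d.edge = e.1).map f).sum * ℓ e.1
      = (L.map fun d => f d * ℓ d.edge).sum := by
  induction L with
  | nil => simp
  | cons d L ih =>
    have hterm (e : G.edgeSet) : (((d :: L).filter fun d => d.edge = e.1).map f).sum * ℓ e.1
        = (if (⟨d.edge, d.edge_mem⟩ : G.edgeSet) = e then f d * ℓ e.1 else 0)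
          + ((L.filter fun d => d.edge = e.1).map f).sum * ℓ e.1 := by
      by_cases he : d.edge = e.1 <;> simp [Subtype.ext_iff, he, add_mul]
    simp [hterm, Finset.sum_add_distrib, ih]

namespace Domain

open PlaneTropicalCurve

variable {d n l : ℕ} {hn : 4 ≤ n} {a : ℕ × ℕ → ℝ} (C : Domain d n hn l a)

/-- The markings `x₃, …, x_n`, which are mapped to given points. -/
def IsPointMarking (i : Fin n) : Prop := 2 ≤ (i : ℕ)

/-- The normal vectors of the edges of the curve of degree `l` through the images of the
markings. -/
noncomputable def normal (i : Fin n) (j : Fin 2) : ℝ := edgeNormal l a (C.ev i) j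

/-- The edge `e` separates `x₁`, `x₂` from `x₃`, `x₄`. -/
abbrev SeparatesFirstTwo (e : Sym2 C.V) : Prop :=
  C.Separates e (firstFour hn 0) (firstFour hn 1) (firstFour hn 2) (firstFour hn 3)

/-- The rate of change of the length of the bounded edge of the four-marked curve, if this is of
type (A). -/
noncomputable abbrev forgetRate : Module.Dual ℝ (Sym2 C.V → ℝ) :=
  C.separatingRate (firstFour hn 0) (firstFour hn 1) (firstFour hn 2) (firstFour hn 3)

theorem isStandardDir (u : C.U) : IsStandardDir (C.endDir u) := by
  have hmem : C.endDir u ∈ C.degree := Multiset.mem_map_of_mem _ (Finset.mem_univ u)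
  rw [C.degree_eq, standardDegree] at hmem
  simp only [Multiset.mem_add, Multiset.mem_replicate] at hmem
  obtain (h | h) | h := hmem
  exacts [.inl h.2, .inr (.inl h.2), .inr (.inr h.2)]

theorem card_ends : Fintype.card C.U = 3 * d := by
  have hcard := congrArg Multiset.card C.degree_eq
  simp only [PlaneTropicalCurve.degree, standardDegree, Multiset.card_map, Multiset.card_add,
    Multiset.card_replicate] at hcard
  rw [Fintype.card, Finset.card_def, hcard]
  ring

variable {C}

theorem separatingLength_eq {t : ℝ} {ht : 0 < t} (h : C.piTilde.2 = M4.A t ht) :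
    C.separatingLength (firstFour hn 0) (firstFour hn 1) (firstFour hn 2) (firstFour hn 3) = t := by
  simp only [piTilde, PlaneTropicalCurve.forget] at h
  split_ifs at h
  exact M4.A.inj h

theorem exists_separatesFirstTwo {t : ℝ} {ht : 0 < t} (h : C.piTilde.2 = M4.A t ht) :
    ∃ e ∈ C.graph.edgeSet, C.SeparatesFirstTwo e := by
  classical
  by_contra! hnone
  refine ht.ne ((separatingLength_eq h).symm.trans ?_).symm
  exact Finset.sum_eq_zero fun e _ => if_neg (hnone e.1 e.2)

open Classical in
theorem forgetCoeff_inr_eq (hsep : ∃ e ∈ C.graph.edgeSet, C.SeparatesFirstTwo e)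
    (e : C.graph.edgeSet) :
    C.forgetCoeff (.inr e) = if C.SeparatesFirstTwo e then 1 else 0 := by
  obtain ⟨f, -, hf⟩ := hsep
  have hB := hf.not_separates (f := e.1)
  have hC := hf.swap.not_separates (f := e.1)
  simp only [forgetCoeff, hB, hC, or_false]

open Classical in
theorem card_row_eq_of_mult_ne_zero (hmult : C.mult ≠ 0) :
    Fintype.card (Row n) = Fintype.card C.Coordinate := by
  by_contra hne
  exact hmult (dif_neg hne)

open Classical in
theorem eq_zero_of_matrix_mulVec_eq_zero (hmult : C.mult ≠ 0) {x : C.Coordinate → ℝ}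
    (hx : C.matrix.mulVec x = 0) : x = 0 := by
  rw [mult, dif_pos (card_row_eq_of_mult_ne_zero hmult), abs_ne_zero] at hmult
  generalize_proofs hcard at hmult
  set e := Fintype.equivOfCardEq hcard
  have hzero : x ∘ e = 0 := Matrix.eq_zero_of_mulVec_eq_zero hmult (by
    rw [Matrix.submatrix_mulVec_equiv, Function.comp_assoc, Equiv.self_comp_symm,
      Function.comp_id, Function.comp_id, hx])
  funext c
  simpa using congrFun hzero (e.symm c)

variable (C) in
/-- The coordinates, in the sense of `Coordinate`, of a variation of `C`. -/
def coordinates (D : C.V → Fin 2 → ℝ) (ℓ : Sym2 C.V → ℝ) : C.Coordinate → ℝ :=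
  Sum.elim (D (C.mark (firstFour hn 0))) fun e => ℓ e.1

open Classical in
theorem posCoeff_dotProduct_coordinates {D : C.V → Fin 2 → ℝ} {ℓ : Sym2 C.V → ℝ}
    (h : (D, ℓ) ∈ C.variations) (v : C.V) (j : Fin 2) :
    C.posCoeff v j ⬝ᵥ C.coordinates D ℓ = D v j := by
  have hpath := sum_sum_filter_edge_mul (C.pathTo v).darts (fun d => (C.dir d.fst d.snd j : ℝ)) ℓ
  rw [sum_darts_eq_sub h] at hpath
  have hroot : ∑ k : Fin 2, (if k = j then (1 : ℝ) else 0) * D (C.mark (firstFour hn 0)) k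
      = D (C.mark (firstFour hn 0)) j := by simp
  rw [dotProduct, Fintype.sum_sum_type]
  simp only [posCoeff, coordinates, Sum.elim_inl, Sum.elim_inr]
  rw [hroot, ← eq_sub_iff_add_eq']
  convert hpath

open Classical in
theorem isRigid (hmult : C.mult ≠ 0) (hsep : ∃ e ∈ C.graph.edgeSet, C.SeparatesFirstTwo e) :
    C.IsRigid IsPointMarking C.normal C.forgetRate := by
  intro D ℓ hmem hD hrate
  obtain ⟨-, hfixed, hnormal⟩ := mem_deformations.mp hD
  have hzero : C.coordinates D ℓ = 0 := by
    refine eq_zero_of_matrix_mulVec_eq_zero hmult (funext fun r => ?_)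
    obtain i | ⟨i, j⟩ | - := r
    · have hrow : C.matrix (.inl i) = ∑ j, C.normal (firstFour hn (Fin.castLE (by omega) i)) j
          • C.posCoeff (C.mark (firstFour hn (Fin.castLE (by omega) i))) j := by
        funext c
        simp [matrix, normal]
      rw [Matrix.mulVec, hrow, sum_dotProduct]
      simp only [smul_dotProduct, posCoeff_dotProduct_coordinates hmem]
      exact hnormal _ (by simp [IsPointMarking]; omega)
    · exact (posCoeff_dotProduct_coordinates hmem _ j).trans (congrFun (hfixed i.1 i.2) j)
    · have hroot (k : Fin 2) : C.forgetCoeff (.inl k) = 0 := rfl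
      rw [Matrix.mulVec, dotProduct, Fintype.sum_sum_type, Pi.zero_apply, ← hrate,
        separatingRate_apply]
      simp [matrix, hroot, forgetCoeff_inr_eq hsep, coordinates]
  refine ⟨funext fun v => funext fun j => ?_, fun e he => congrFun hzero (.inr ⟨e, he⟩)⟩
  rw [← posCoeff_dotProduct_coordinates hmem v j, hzero, dotProduct_zero]
  rfl

open Classical in
theorem eq_of_mark_eq (hmult : C.mult ≠ 0) {i i' : Fin n} (hi : IsPointMarking i)
    (hi' : IsPointMarking i') (hmark : C.mark i = C.mark i') : i = i' := by
  by_contra hne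
  have hcard := card_row_eq_of_mult_ne_zero hmult
  rw [mult, dif_pos hcard] at hmult
  refine hmult (abs_eq_zero.mpr (Matrix.det_zero_of_row_eq (i := .inr (.inl (⟨i, hi⟩, 0)))
    (j := .inr (.inl (⟨i', hi'⟩, 0))) (by simpa [Subtype.ext_iff] using hne) (funext fun c => ?_)))
  simp only [Matrix.submatrix_apply, matrix, id_eq, hmark]

end Domain

namespace PlaneTropicalCurve

variable {I : Type} [Fintype I] {C : PlaneTropicalCurve I} {E : C.ContractedEdge}

theorem ContractedEdge.mem_side_of_separates {i j k m : I}
    (h : C.Separates s(E.fst, E.snd) i j k m) (hi : C.mark i ∈ E.side) :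
    C.mark j ∈ E.side ∧ C.mark k ∈ E.symm.side ∧ C.mark m ∈ E.symm.side := by
  have hfst : (C.graph.deleteEdges {s(E.fst, E.snd)}).Reachable E.fst (C.mark i) := hi
  have hk : C.mark k ∉ E.side := fun hk => h.2.2 (hfst.symm.trans hk)
  exact ⟨hfst.trans h.1, mem_symm_side.mpr hk,
    mem_symm_side.mpr fun hm => hk (SimpleGraph.Reachable.trans hm h.2.1.symm)⟩

namespace ContractedEdge

variable (E)

theorem card_endsIn_add_card_endsIn_symm :
    (C.endsIn E.sideFinset).card + (C.endsIn E.symm.sideFinset).card = Fintype.card C.U := by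
  classical
  rw [← Finset.card_univ, ← Finset.card_filter_add_card_filter_not (s := Finset.univ)
    fun u => C.endAt u ∈ E.side]
  congr 1 <;> refine congrArg _ (Finset.ext fun u => ?_) <;>
    simp [mem_endsIn, mem_sideFinset, mem_symm_side]

theorem card_filter_marksIn_add_card_filter_marksIn_symm (P : I → Prop) [DecidablePred P] :
    ((C.marksIn E.sideFinset).filter P).card + ((C.marksIn E.symm.sideFinset).filter P).card
      = (Finset.univ.filter P).card := by
  classical
  rw [← Finset.card_filter_add_card_filter_not (s := Finset.univ.filter P)
    fun i => C.mark i ∈ E.side]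
  congr 2 <;> ext i <;> simp [mem_marksIn, mem_sideFinset, mem_symm_side, and_comm]

end ContractedEdge

open Classical in
theorem IsRigid.card_endsIn_sideFinset_le {P : I → Prop} {ν : I → Fin 2 → ℝ}
    {Λ : Module.Dual ℝ (Sym2 C.V → ℝ)} (h : C.IsRigid P ν Λ) (hC : C.IsTrivalent)
    (hside : E.symm.side ≠ {E.snd}) :
    (C.endsIn E.sideFinset).card ≤ ((C.marksIn E.sideFinset).filter P).card + 1 :=
  ContractedEdge.card_endsIn_sideFinset_le hC (fun _ hD heq => h.eq_zero_of_eq E hD heq)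
    fun _ hi => hside ((h.isUnique E).symm.side_eq_singleton_of_mark_eq hC hi)

theorem ContractedEdge.IsUnique.card_endsIn_sideFinset_pos (hE : E.IsUnique)
    (hside : E.side ≠ {E.fst}) : 0 < (C.endsIn E.sideFinset).card :=
  Finset.card_pos.mpr <| Finset.nonempty_iff_ne_empty.mpr
    fun h => hside (hE.side_eq_singleton_of_endsIn_eq_empty h)

end PlaneTropicalCurve

namespace Domain

open PlaneTropicalCurve

variable {d l : ℕ} {a : ℕ × ℕ → ℝ}

open Classical in
theorem card_filter_isPointMarking {n : ℕ} (hn : 2 < n) :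
    ((Finset.univ : Finset (Fin n)).filter IsPointMarking).card = n - 2 := by
  rw [← Fin.card_Ici ⟨2, hn⟩]
  refine congrArg _ (Finset.ext fun i => ?_)
  simp [IsPointMarking, Fin.le_def]

section

variable {n : ℕ} {hn : 4 ≤ n} {C : Domain d n hn l a} {E : C.ContractedEdge}

theorem side_ne_singleton (hadj : ¬ C.FirstTwoAdjacent) (h₀ : C.mark (firstFour hn 0) ∈ E.side)
    (h₁ : C.mark (firstFour hn 1) ∈ E.side) : E.side ≠ {E.fst} := by
  intro hside
  rw [hside, Set.mem_singleton_iff] at h₀ h₁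
  exact hadj (h₀.trans h₁.symm)

theorem symm_side_ne_singleton (hmult : C.mult ≠ 0)
    (h₂ : C.mark (firstFour hn 2) ∈ E.symm.side) (h₃ : C.mark (firstFour hn 3) ∈ E.symm.side) :
    E.symm.side ≠ {E.snd} := by
  intro hside
  rw [hside, Set.mem_singleton_iff] at h₂ h₃
  have heq := eq_of_mark_eq hmult (by simp [IsPointMarking]) (by simp [IsPointMarking])
    (h₂.trans h₃.symm)
  simp [Fin.ext_iff] at heq

open Classical in
theorem setOf_four_le_mark_mem_side (h₂ : C.mark (firstFour hn 2) ∉ E.side)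
    (h₃ : C.mark (firstFour hn 3) ∉ E.side) :
    {i : Fin n | 4 ≤ (i : ℕ) ∧ C.mark i ∈ E.side}
      = ((C.marksIn E.sideFinset).filter IsPointMarking : Finset (Fin n)) := by
  ext i
  rw [Finset.mem_coe, Finset.mem_filter, mem_marksIn, ContractedEdge.mem_sideFinset,
    Set.mem_ofPred_eq, and_comm]
  refine and_congr_right fun hi => ⟨fun h => le_trans (by norm_num) h, fun h => ?_⟩
  have hi₂ : (i : ℕ) ≠ 2 := fun h => h₂ (by rwa [show firstFour hn 2 = i from Fin.ext h.symm])
  have hi₃ : (i : ℕ) ≠ 3 := fun h => h₃ (by rwa [show firstFour hn 3 = i from Fin.ext h.symm])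
  rw [IsPointMarking] at h
  omega

end

variable {hn : 4 ≤ 3 * d} {C : Domain d (3 * d) hn l a}

/-- A component with `m` unbounded edges has at least `m - 1` markings at given points. These bounds
add up to the number `3 * d - 2` of all such markings, so both are equalities. -/
theorem decomposesUniquely_of_mem_side (hC : C.IsTrivalent) (hmult : C.mult ≠ 0)
    (hsep : ∃ e ∈ C.graph.edgeSet, C.SeparatesFirstTwo e) (hadj : ¬ C.FirstTwoAdjacent)
    (E : C.ContractedEdge) (h₀ : C.mark (firstFour hn 0) ∈ E.side) : C.DecomposesUniquely := by
  classical
  have hrigid := isRigid hmult hsep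
  have hE := hrigid.isUnique E
  obtain ⟨h₁, h₂, h₃⟩ := ContractedEdge.mem_side_of_separates (hrigid.separates E) h₀
  have hside₁ := side_ne_singleton hadj h₀ h₁
  have hside₂ := symm_side_ne_singleton hmult h₂ h₃
  obtain ⟨d₁, hdegree₁, hends₁⟩ := E.exists_degree_component_eq C.isStandardDir
  obtain ⟨d₂, hdegree₂, hends₂⟩ := E.symm.exists_degree_component_eq C.isStandardDir
  have hpos₁ := hE.card_endsIn_sideFinset_pos hside₁
  have hpos₂ := hE.symm.card_endsIn_sideFinset_pos hside₂
  have hle₁ := hrigid.card_endsIn_sideFinset_le hC hside₂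
  have hle₂ := hrigid.card_endsIn_sideFinset_le (E := E.symm) hC hside₁
  have hends := E.card_endsIn_add_card_endsIn_symm
  have hmarks := E.card_filter_marksIn_add_card_filter_marksIn_symm IsPointMarking
  rw [C.card_ends] at hends
  rw [card_filter_isPointMarking (by omega)] at hmarks
  refine ⟨E, hE, d₁, d₂, by omega, by omega, by omega, hdegree₁, hdegree₂, h₀, h₁, h₂, h₃, ?_⟩
  rw [setOf_four_le_mark_mem_side (ContractedEdge.mem_symm_side.mp h₂)
    (ContractedEdge.mem_symm_side.mp h₃), Set.ncard_coe_finset]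
  omega

theorem decomposesUniquely (hC : C.IsTrivalent) (hmult : C.mult ≠ 0)
    (hsep : ∃ e ∈ C.graph.edgeSet, C.SeparatesFirstTwo e) (hadj : ¬ C.FirstTwoAdjacent)
    (E : C.ContractedEdge) : C.DecomposesUniquely := by
  by_cases h₀ : C.mark (firstFour hn 0) ∈ E.side
  · exact decomposesUniquely_of_mem_side hC hmult hsep hadj E h₀
  · exact decomposesUniquely_of_mem_side hC hmult hsep hadj E.symm
      (ContractedEdge.mem_symm_side.mpr h₀)

end Domain

/-! ### The directions in which a tropical curve of degree `l` is unbounded -/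

theorem mem_exponents {l : ℕ} {m : ℕ × ℕ} : m ∈ exponents l ↔ m.1 + m.2 ≤ l := by
  simp only [exponents, Finset.mem_filter, Finset.mem_product, Finset.mem_range]
  omega

/-- The triangle of exponents has the vertices `(0, 0)`, `(l, 0)` and `(0, l)`, so that `l * c` is
the maximum over it. The claim is complementary slackness. -/
theorem slack_eq_zero {l : ℕ} {x : Fin 2 → ℝ} {m : ℕ × ℕ} (hm : m ∈ exponents l)
    (hmax : ∀ m' ∈ exponents l, (m'.1 : ℝ) * x 0 + m'.2 * x 1 ≤ m.1 * x 0 + m.2 * x 1)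
    {c : ℝ} (hc : c = max 0 (max (x 0) (x 1))) :
    (m.1 : ℝ) * (c - x 0) = 0 ∧ (m.2 : ℝ) * (c - x 1) = 0 ∧ ((l : ℝ) - m.1 - m.2) * c = 0 := by
  have hx₀ : x 0 ≤ c := hc ▸ (le_max_left _ _).trans (le_max_right _ _)
  have hx₁ : x 1 ≤ c := hc ▸ (le_max_right _ _).trans (le_max_right _ _)
  have hc₀ : 0 ≤ c := hc ▸ le_max_left _ _
  have hl : (m.1 : ℝ) + m.2 ≤ l := by exact_mod_cast mem_exponents.mp hm
  have hle : (l : ℝ) * c ≤ m.1 * x 0 + m.2 * x 1 := by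
    have h₀ := hmax (0, 0) (mem_exponents.mpr (by simp))
    have h₁ := hmax (l, 0) (mem_exponents.mpr (by simp))
    have h₂ := hmax (0, l) (mem_exponents.mpr (by simp))
    simp only [Nat.cast_zero, zero_mul, add_zero, zero_add] at h₀ h₁ h₂
    rw [hc, mul_max_of_nonneg _ _ l.cast_nonneg, mul_max_of_nonneg _ _ l.cast_nonneg, mul_zero]
    exact max_le h₀ (max_le h₁ h₂)
  have hnonneg₁ : 0 ≤ (m.1 : ℝ) * (c - x 0) := mul_nonneg m.1.cast_nonneg (by linarith)
  have hnonneg₂ : 0 ≤ (m.2 : ℝ) * (c - x 1) := mul_nonneg m.2.cast_nonneg (by linarith)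
  have hnonneg₃ : 0 ≤ ((l : ℝ) - m.1 - m.2) * c := mul_nonneg (by linarith) hc₀
  refine ⟨?_, ?_, ?_⟩ <;> linarith

theorem two_of_three_tight {l : ℕ} {x : Fin 2 → ℝ} {M : Finset (ℕ × ℕ)}
    (hM : M ⊆ exponents l) (hcard : 2 ≤ M.card) (hmax : ∀ m ∈ M, ∀ m' ∈ exponents l,
      (m'.1 : ℝ) * x 0 + m'.2 * x 1 ≤ m.1 * x 0 + m.2 * x 1)
    {c : ℝ} (hc : c = max 0 (max (x 0) (x 1))) :
    (x 0 = c ∨ x 1 = c) ∧ (x 0 = c ∨ c = 0) ∧ (x 1 = c ∨ c = 0) := by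
  have hslack (m) (hm : m ∈ M) := slack_eq_zero (hM hm) (hmax m hm) hc
  have hnot_unique (p : ℕ × ℕ) : ∃ m ∈ M, m ≠ p := Finset.exists_mem_ne hcard p
  refine ⟨?_, ?_, ?_⟩
  · by_contra! hne
    obtain ⟨m, hm, hm'⟩ := hnot_unique (0, 0)
    have h₁ := (mul_eq_zero.mp (hslack m hm).1).resolve_right (sub_ne_zero.mpr hne.1.symm)
    have h₂ := (mul_eq_zero.mp (hslack m hm).2.1).resolve_right (sub_ne_zero.mpr hne.2.symm)
    exact hm' (Prod.ext (by exact_mod_cast h₁) (by exact_mod_cast h₂))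
  · by_contra! hne
    obtain ⟨m, hm, hm'⟩ := hnot_unique (0, l)
    have h₁ := (mul_eq_zero.mp (hslack m hm).1).resolve_right (sub_ne_zero.mpr hne.1.symm)
    have h₂ := (mul_eq_zero.mp (hslack m hm).2.2).resolve_right hne.2
    rw [h₁, sub_zero, sub_eq_zero] at h₂
    exact hm' (Prod.ext (by exact_mod_cast h₁) (by exact_mod_cast h₂.symm))
  · by_contra! hne
    obtain ⟨m, hm, hm'⟩ := hnot_unique (l, 0)
    have h₁ := (mul_eq_zero.mp (hslack m hm).2.1).resolve_right (sub_ne_zero.mpr hne.1.symm)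
    have h₂ := (mul_eq_zero.mp (hslack m hm).2.2).resolve_right hne.2
    rw [h₁, sub_zero, sub_eq_zero] at h₂
    exact hm' (Prod.ext (by exact_mod_cast h₂.symm) (by exact_mod_cast h₁))

theorem exists_eq_smul_isStandardDir {l : ℕ} {x : Fin 2 → ℝ} {M : Finset (ℕ × ℕ)}
    (hM : M ⊆ exponents l) (hcard : 2 ≤ M.card) (hmax : ∀ m ∈ M, ∀ m' ∈ exponents l,
      (m'.1 : ℝ) * x 0 + m'.2 * x 1 ≤ m.1 * x 0 + m.2 * x 1) :
    ∃ s : ℝ, 0 ≤ s ∧ ∃ e, IsStandardDir e ∧ x = s • fun j => (e j : ℝ) := by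
  obtain ⟨c, hc⟩ : ∃ c, c = max 0 (max (x 0) (x 1)) := ⟨_, rfl⟩
  obtain ⟨h₀₁, h₀, h₁⟩ := two_of_three_tight hM hcard hmax hc
  have hx₀ : x 0 ≤ c := hc ▸ (le_max_left _ _).trans (le_max_right _ _)
  have hx₁ : x 1 ≤ c := hc ▸ (le_max_right _ _).trans (le_max_right _ _)
  have hc₀ : 0 ≤ c := hc ▸ le_max_left _ _
  have hext {y : Fin 2 → ℝ} (h : x 0 = y 0) (h' : x 1 = y 1) : x = y :=
    funext (Fin.forall_fin_two.mpr ⟨h, h'⟩)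
  obtain h₁₁ | rfl := h₁
  · obtain h₀₀ | rfl := h₀
    · exact ⟨c, hc₀, _, .inr (.inr rfl), hext (by simpa) (by simpa)⟩
    · exact ⟨-x 0, by linarith, _, .inl rfl, hext (by simp) (by simpa)⟩
  · obtain h₀₀ | h₁₁ := h₀₁
    · exact ⟨-x 1, by linarith, _, .inr (.inl rfl), hext (by simpa) (by simp)⟩
    · exact ⟨-x 0, by linarith, _, .inl rfl, hext (by simp) (by simpa)⟩

theorem mem_maximizers {l : ℕ} {a : ℕ × ℕ → ℝ} {q : Fin 2 → ℝ} {m : ℕ × ℕ} :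
    m ∈ maximizers l a q ↔
      m ∈ exponents l ∧ ∀ m' ∈ exponents l, monomialValue a q m' ≤ monomialValue a q m :=
  Finset.mem_filter

theorem edgeNormal_dotProduct_sub_eq_zero {l : ℕ} {a : ℕ × ℕ → ℝ} {q q' : Fin 2 → ℝ}
    (h : maximizers l a q = maximizers l a q') :
    (fun j => (edgeNormal l a q j : ℝ)) ⬝ᵥ (q' - q) = 0 := by
  obtain ⟨m, hm, m', hm', hnormal⟩ := (exists_longest l a q).choose_spec.1
  have hvalue {x : Fin 2 → ℝ} (hm : m ∈ maximizers l a x) (hm' : m' ∈ maximizers l a x) :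
      monomialValue a x m = monomialValue a x m' :=
    le_antisymm ((mem_maximizers.mp hm').2 m (mem_maximizers.mp hm).1)
      ((mem_maximizers.mp hm).2 m' (mem_maximizers.mp hm').1)
  have hq := hvalue hm hm'
  have hq' := hvalue (h ▸ hm) (h ▸ hm')
  simp only [monomialValue] at hq hq'
  rw [edgeNormal, hnormal]
  simp only [dotProduct, Fin.sum_univ_two, exponentDiff, Matrix.cons_val_zero,
    Matrix.cons_val_one, Int.cast_sub, Int.cast_natCast, Pi.sub_apply]
  linear_combination hq' - hq

/-! ### Unbounded families of curves -/

theorem eq_of_reachable_deleteEdges_of_leaf {V : Type*} {G : SimpleGraph V} {v w z : V}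
    (hleaf : ∀ w', G.Adj v w' → w' = w) (hz : (G.deleteEdges {s(v, w)}).Reachable v z) :
    z = v := by
  obtain ⟨p⟩ := hz
  cases p with
  | nil => rfl
  | cons hvw' _ =>
    rw [SimpleGraph.deleteEdges_adj] at hvw'
    exact absurd (by rw [hleaf _ hvw'.1]; rfl) hvw'.2

theorem nonpos_of_forall_exists_add_mul_nonpos {x y : ℝ}
    (h : ∀ K : ℝ, ∃ c, K < c ∧ x + c * y ≤ 0) : y ≤ 0 := by
  by_contra! hy
  obtain ⟨c, hc, hle⟩ := h (-x / y)
  rw [div_lt_iff₀ hy] at hc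
  linarith

namespace PlaneTropicalCurve

variable {I : Type} [Fintype I] {C : PlaneTropicalCurve I}

theorem ne_of_mem_variations {D : C.V → Fin 2 → ℝ} {ℓ : Sym2 C.V → ℝ}
    (h : (D, ℓ) ∈ C.variations) {v w : C.V} (hvw : C.graph.Adj v w) (hdir : C.dir v w ≠ 0)
    (hlen : ℓ s(v, w) ≠ 0) : D v ≠ D w := by
  intro heq
  refine hdir (funext fun j => ?_)
  have hzero : D w j - D v j = ℓ s(v, w) * C.dir v w j := h v w hvw j
  rw [heq, sub_self, eq_comm] at hzero
  exact_mod_cast (mul_eq_zero.mp hzero).resolve_left hlen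

/-- A separating edge which is lengthened is the edge at the moving leaf; but neither `i` and `j`
nor `k` can be at this leaf. -/
theorem IsUnboundedDeformation.separatingRate_eq_zero {P : I → Prop} {ν : I → Fin 2 → ℝ}
    {D : C.V → Fin 2 → ℝ} {ℓ : Sym2 C.V → ℝ} {i j k m : I} (h : C.IsUnboundedDeformation P ν D ℓ)
    (hC : C.IsTrivalent) (hends : ∀ u, IsStandardDir (C.endDir u))
    (hcontracted : ∀ v w, C.graph.Adj v w → C.dir v w ≠ 0) (hij : C.mark i ≠ C.mark j)
    (hk : P k) : C.separatingRate i j k m ℓ = 0 := by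
  classical
  rw [separatingRate_apply]
  refine Finset.sum_eq_zero fun ⟨e, he⟩ _ => ite_eq_right_iff.mpr fun hsep => ?_
  by_contra hlen
  have hends_ne {x y : C.V} (hxy : C.graph.Adj x y) (he : e = s(x, y)) : D x ≠ D y :=
    ne_of_mem_variations h.mem_variations hxy (hcontracted x y hxy) (he ▸ hlen)
  have hD : D ≠ 0 := by
    rintro rfl
    induction e with | h x y => exact hends_ne he rfl rfl
  obtain ⟨v, hfixed, hleaf⟩ := h.exists_isMovingLeaf hC hends hD
  obtain ⟨w, hvw, rfl⟩ : ∃ w, C.graph.Adj v w ∧ e = s(v, w) := by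
    induction e with | h x y =>
    obtain rfl | hx := eq_or_ne x v
    · exact ⟨y, he, rfl⟩
    obtain rfl | hy := eq_or_ne y v
    · exact ⟨x, SimpleGraph.Adj.symm he, Sym2.eq_swap⟩
    · exact absurd ((hfixed x hx).trans (hfixed y hy).symm) (hends_ne he rfl)
  have hside {z : C.V} (hz : (C.graph.deleteEdges {s(v, w)}).Reachable v z) : z = v :=
    eq_of_reachable_deleteEdges_of_leaf (fun w' hw' => hleaf w' w hw' hvw) hz
  obtain hi | hi := reachable_deleteEdges_or C.preconnected v w (C.mark i)
  · exact hij ((hside hi).trans (hside (hi.trans hsep.1)).symm)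
  obtain hk' | hk' := reachable_deleteEdges_or C.preconnected v w (C.mark k)
  · refine hends_ne hvw rfl ?_
    rw [← hside hk', (PlaneTropicalCurve.mem_deformations.mp h.mem_deformations).2.1 k hk]
    exact (hfixed w (hside hk' ▸ hvw.ne')).symm
  · exact hsep.2.2 (hi.symm.trans hk')

theorem abs_dir_le_card_ends (hends : ∀ u, IsStandardDir (C.endDir u)) {v w : C.V}
    (hvw : C.graph.Adj v w) (j : Fin 2) : |C.dir v w j| ≤ Fintype.card C.U := by
  have hbalance := C.sum_boundary_dir_apply_add_sum_endDir_apply (edgeSide C.graph v w) j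
  rw [boundary_edgeSide C.isAcyclic hvw, Finset.sum_singleton] at hbalance
  rw [eq_neg_of_add_eq_zero_left hbalance, abs_neg]
  calc |∑ u ∈ C.endsIn (edgeSide C.graph v w), C.endDir u j|
      ≤ ∑ u ∈ C.endsIn (edgeSide C.graph v w), |C.endDir u j| := Finset.abs_sum_le_sum_abs _ _
    _ ≤ (C.endsIn (edgeSide C.graph v w)).card := by
      rw [Finset.cast_card]
      refine Finset.sum_le_sum fun u _ => ?_
      obtain hu | hu | hu := hends u <;> rw [hu] <;> fin_cases j <;> simp
    _ ≤ Fintype.card C.U := by exact_mod_cast Finset.card_le_univ _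

/-- An isomorphism of the combinatorial types of two curves. The unbounded edges other than the
markings are left out. -/
structure TypeIso (C C' : PlaneTropicalCurve I) where
  iso : C.graph ≃g C'.graph
  dir_eq : ∀ v w, C.graph.Adj v w → C'.dir (iso v) (iso w) = C.dir v w
  mark_eq : ∀ i, C'.mark i = iso (C.mark i)

namespace TypeIso

variable {C' : PlaneTropicalCurve I} (g : TypeIso C C')

/-- The displacements of the vertices from `C` to `C'`. -/
def displacement : C.V → Fin 2 → ℝ := fun v => C'.pos (g.iso v) - C.pos v

/-- The changes of the lengths of the bounded edges from `C` to `C'`. -/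
def lenChange : Sym2 C.V → ℝ := C'.len ∘ Sym2.map g.iso - C.len

theorem displacement_mark (i : I) : g.displacement (C.mark i) = C'.ev i - C.ev i := by
  rw [displacement, ← g.mark_eq]
  rfl

theorem mem_variations : (g.displacement, g.lenChange) ∈ C.variations := by
  intro v w hvw j
  have hpos := C.pos_sub v w hvw j
  have hpos' := C'.pos_sub _ _ (g.iso.map_adj_iff.mpr hvw) j
  rw [g.dir_eq v w hvw] at hpos'
  simp only [displacement, lenChange, Pi.sub_apply, Function.comp_apply, Sym2.map_mk]
  linear_combination hpos' - hpos

/-- The isomorphism of the underlying trees without an edge. -/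
def deleteIso (e : Sym2 C.V) :
    C.graph.deleteEdges {e} ≃g C'.graph.deleteEdges {e.map g.iso} where
  toEquiv := g.iso.toEquiv
  map_rel_iff' {v w} := by
    rw [SimpleGraph.deleteEdges_adj, SimpleGraph.deleteEdges_adj]
    refine and_congr g.iso.map_adj_iff (not_congr ?_)
    rw [Set.mem_singleton_iff, Set.mem_singleton_iff, ← Sym2.map_mk]
    exact (Sym2.map.injective g.iso.injective).eq_iff

theorem separates_map_iff {e : Sym2 C.V} {i j k m : I} :
    C'.Separates (e.map g.iso) i j k m ↔ C.Separates e i j k m := by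
  have hreachable (i j : I) :
      (C'.graph.deleteEdges {e.map g.iso}).Reachable (C'.mark i) (C'.mark j)
        ↔ (C.graph.deleteEdges {e}).Reachable (C.mark i) (C.mark j) := by
    rw [g.mark_eq, g.mark_eq]
    exact (g.deleteIso e).reachable_iff
  simp only [Separates, hreachable]

theorem separatingRate_comp_map (i j k m : I) (ℓ : Sym2 C'.V → ℝ) :
    C.separatingRate i j k m (ℓ ∘ Sym2.map g.iso) = C'.separatingRate i j k m ℓ := by
  classical
  rw [separatingRate_apply, separatingRate_apply]
  refine Fintype.sum_equiv g.iso.mapEdgeSet _ _ fun e => ?_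
  change _ = if C'.Separates (e.1.map g.iso) i j k m then ℓ (e.1.map g.iso) else 0
  simp only [g.separates_map_iff, Function.comp_apply]

theorem separatingRate_lenChange (i j k m : I) : C.separatingRate i j k m g.lenChange
    = C'.separatingLength i j k m - C.separatingLength i j k m := by
  rw [lenChange, map_sub, separatingRate_comp_map, separatingRate_len, separatingRate_len]

end TypeIso

end PlaneTropicalCurve

namespace Domain

open PlaneTropicalCurve

variable {d n l : ℕ} {hn : 4 ≤ n} {a : ℕ × ℕ → ℝ}

/-- `C` and `C'` have isomorphic combinatorial types, and the images of `x₁` and of `x₂` on both of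
them lie in the same cell of the curve of degree `l`. -/
structure SameType (C C' : Domain d n hn l a) extends
    TypeIso C.toPlaneTropicalCurve C'.toPlaneTropicalCurve where
  maximizers_eq : ∀ i, ¬ IsPointMarking i → maximizers l a (C.ev i) = maximizers l a (C'.ev i)

variable {C C' : Domain d n hn l a}

theorem SameType.displacement_mem_deformations (g : SameType C C')
    (hev : ∀ i, IsPointMarking i → C'.ev i = C.ev i) :
    g.displacement ∈ C.deformations IsPointMarking C.normal := by
  refine mem_deformations.mpr ⟨fun v w hvw => bend_eq_zero_of_mem_variations g.mem_variations hvw,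
    fun i hi => ?_, fun i hi => ?_⟩
  · rw [g.displacement_mark, hev i hi, sub_self]
  · rw [g.displacement_mark]
    exact edgeNormal_dotProduct_sub_eq_zero (g.maximizers_eq i hi)

theorem two_le_card_maximizers (C : Domain d n hn l a) {i : Fin n} (hi : ¬ IsPointMarking i) :
    2 ≤ (maximizers l a (C.ev i)).card := by
  rw [IsPointMarking, not_le] at hi
  obtain h | h : (i : ℕ) = 0 ∨ (i : ℕ) = 1 := by omega
  · exact (show i = firstFour hn 0 from Fin.ext h) ▸ C.ev_first
  · exact (show i = firstFour hn 1 from Fin.ext h) ▸ C.ev_second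

theorem isUnboundedDeformation (hrigid : C.IsRigid IsPointMarking C.normal C.forgetRate)
    (hcontracted : ∀ v w, C.graph.Adj v w → C.dir v w ≠ 0) {D : C.V → Fin 2 → ℝ}
    {ℓ : Sym2 C.V → ℝ} (hmem : (D, ℓ) ∈ C.variations)
    (hD : D ∈ C.deformations IsPointMarking C.normal) (hrate : C.forgetRate ℓ ≠ 0)
    (hunbounded : ∀ K : ℝ, ∃ c, K < c ∧ ∃ (C' : Domain d n hn l a) (g : SameType C C'),
      g.displacement = c • D ∧ ∀ e ∈ C.graph.edgeSet, g.lenChange e = c * ℓ e) :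
    C.IsUnboundedDeformation IsPointMarking C.normal D ℓ where
  mem_variations := hmem
  len_nonneg v w hvw := by
    refine neg_nonpos.mp (nonpos_of_forall_exists_add_mul_nonpos (x := -C.len s(v, w)) fun K => ?_)
    obtain ⟨c, hc, C', g, -, hlen⟩ := hunbounded K
    have hpos := C'.len_pos (s(v, w).map g.iso) (g.iso.map_adj_iff.mpr hvw)
    have hchange := hlen s(v, w) hvw
    simp only [TypeIso.lenChange, Pi.sub_apply, Function.comp_apply] at hchange
    exact ⟨c, hc, by linarith⟩
  mem_deformations := hD
  deformations_le := hrigid.deformations_le_span hcontracted hmem hD hrate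
  exists_fixed := ⟨firstFour hn 2, le_rfl⟩
  recession i hi := by
    refine exists_eq_smul_isStandardDir (M := maximizers l a (C.ev i))
      (fun m hm => (mem_maximizers.mp hm).1) (C.two_le_card_maximizers hi) fun m hm m' hm' => ?_
    refine sub_nonpos.mp (nonpos_of_forall_exists_add_mul_nonpos
      (x := monomialValue a (C.ev i) m' - monomialValue a (C.ev i) m) fun K => ?_)
    obtain ⟨c, hc, C', g, hdisplacement, -⟩ := hunbounded K
    have hev (j : Fin 2) : C'.ev i j = C.ev i j + c * D (C.mark i) j := by
      have hmark := congrFun (g.displacement_mark i) j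
      rw [hdisplacement] at hmark
      simp only [Pi.smul_apply, Pi.sub_apply, smul_eq_mul] at hmark
      linarith
    rw [g.maximizers_eq i hi] at hm
    have hle := (mem_maximizers.mp hm).2 m' hm'
    simp only [monomialValue, hev] at hle ⊢
    exact ⟨c, hc, by linarith⟩

theorem exists_bound_of_sameType (hC : C.IsTrivalent) (hmult : C.mult ≠ 0)
    (hadj : ¬ C.FirstTwoAdjacent) (hcontracted : ∀ v w, C.graph.Adj v w → C.dir v w ≠ 0)
    {p : PointMarking n → Fin 2 → ℝ} {t : ℝ} {ht : 0 < t} (hpi : C.piTilde = (p, M4.A t ht)) :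
    ∃ R : ℝ, ∀ (t' : ℝ) (ht' : 0 < t') (C' : Domain d n hn l a), Nonempty (SameType C C') →
      C'.piTilde = (p, M4.A t' ht') → t' ≤ R := by
  by_contra! hunbounded
  have hrigid := isRigid hmult (exists_separatesFirstTwo (congrArg Prod.snd hpi))
  have hdeformation {t' : ℝ} {ht' : 0 < t'} {C' : Domain d n hn l a} (g : SameType C C')
      (hpi' : C'.piTilde = (p, M4.A t' ht')) :
      g.displacement ∈ C.deformations IsPointMarking C.normal ∧
        C.forgetRate g.lenChange = t' - t := by
    refine ⟨g.displacement_mem_deformations fun i hi => ?_, ?_⟩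
    · exact congrFun ((congrArg Prod.fst hpi').trans (congrArg Prod.fst hpi).symm) ⟨i, hi⟩
    · rw [g.separatingRate_lenChange, separatingLength_eq (congrArg Prod.snd hpi),
        separatingLength_eq (congrArg Prod.snd hpi')]
  obtain ⟨t₁, ht₁, C₁, ⟨g₁⟩, hpi₁, hlt₁⟩ := hunbounded t
  obtain ⟨hD, hrate⟩ := hdeformation g₁ hpi₁
  have hrate_ne : C.forgetRate g₁.lenChange ≠ 0 := hrate ▸ (sub_pos.mpr hlt₁).ne'
  refine hrate_ne (IsUnboundedDeformation.separatingRate_eq_zero (isUnboundedDeformation hrigid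
    hcontracted g₁.mem_variations hD hrate_ne fun K => ?_) hC C.isStandardDir hcontracted hadj
    (show IsPointMarking (firstFour hn 2) from le_rfl))
  obtain ⟨t', ht', C', ⟨g⟩, hpi', hlt⟩ := hunbounded (t + K * (t₁ - t))
  obtain ⟨hD', hrate'⟩ := hdeformation g hpi'
  refine ⟨C.forgetRate g.lenChange / C.forgetRate g₁.lenChange, ?_, C', g,
    hrigid.eq_smul g₁.mem_variations hD hrate_ne g.mem_variations hD'⟩
  rw [hrate, hrate', lt_div_iff₀ (sub_pos.mpr hlt₁)]
  linarith

/-! ### Finiteness of the number of combinatorial types -/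

/-- Combinatorial types of curves with the vertices `0, …, N - 1` and with direction vectors bounded
by `B`, together with a choice of monomials of degree at most `l` at every marking. -/
abbrev CombType (n l N B : ℕ) : Type :=
  (Fin N → Fin N → Prop) × (Fin N → Fin N → Fin 2 → Finset.Icc (-(B : ℤ)) B) ×
    (Fin n → Fin N) × (Fin n → (exponents l).powerset)

open Classical in
/-- The combinatorial type of a curve, for an enumeration of its vertices. The entries for the
directions between vertices which are not adjacent are zero. -/
noncomputable def combType (C : Domain d n hn l a) {N : ℕ} (f : C.V ≃ Fin N) :
    CombType n l N (3 * d) :=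
  (fun x y => C.graph.Adj (f.symm x) (f.symm y),
    fun x y j => if h : C.graph.Adj (f.symm x) (f.symm y) then
        ⟨C.dir (f.symm x) (f.symm y) j,
          Finset.mem_Icc.mpr (abs_le.mp (C.card_ends ▸ abs_dir_le_card_ends C.isStandardDir h j))⟩
      else ⟨0, by simp⟩,
    fun i => f (C.mark i),
    fun i => ⟨maximizers l a (C.ev i),
      Finset.mem_powerset.mpr fun _ hm => (mem_maximizers.mp hm).1⟩)

theorem nonempty_sameType {N : ℕ} {f : C.V ≃ Fin N} {f' : C'.V ≃ Fin N}
    (h : C.combType f = C'.combType f') : Nonempty (SameType C C') := by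
  simp only [combType, Prod.mk.injEq] at h
  obtain ⟨hgraph, hdir, hmark, hmax⟩ := h
  have hadj (v w : C.V) : C'.graph.Adj (f'.symm (f v)) (f'.symm (f w)) ↔ C.graph.Adj v w := by
    simpa using (congrFun (congrFun hgraph (f v)) (f w)).symm.to_iff
  refine ⟨⟨⟨⟨f.trans f'.symm, hadj _ _⟩, fun v w hvw => funext fun j => ?_, fun i => ?_⟩,
    fun i _ => congrArg Subtype.val (congrFun hmax i)⟩⟩
  · have hentry := congrArg Subtype.val (congrFun (congrFun (congrFun hdir (f v)) (f w)) j)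
    rw [dif_pos (by simpa using hvw), dif_pos ((hadj v w).mpr hvw)] at hentry
    change C'.dir (f'.symm (f v)) (f'.symm (f w)) j = C.dir v w j
    simpa only [Equiv.symm_apply_apply] using hentry.symm
  · exact f'.eq_symm_apply.mpr (congrFun hmark i).symm

theorem card_vertices (hmult : C.mult ≠ 0) : Fintype.card C.V = Fintype.card (Row n) - 1 := by
  classical
  have hedges := C.isTree.card_edgeFinset
  rw [SimpleGraph.edgeFinset_card] at hedges
  rw [card_row_eq_of_mult_ne_zero hmult, Fintype.card_sum, Fintype.card_fin, ← hedges]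
  omega

theorem exists_bound_of_forall_dir_ne_zero (d l : ℕ) {n : ℕ} (hn : 4 ≤ n) (a : ℕ × ℕ → ℝ)
    (p : PointMarking n → Fin 2 → ℝ) : ∃ R : ℝ, ∀ (t : ℝ) (ht : 0 < t) (C : Domain d n hn l a),
      C.piTilde = (p, M4.A t ht) → C.IsTrivalent → C.mult ≠ 0 → ¬ C.FirstTwoAdjacent →
        (∀ v w, C.graph.Adj v w → C.dir v w ≠ 0) → t ≤ R := by
  have hbound (τ : CombType n l (Fintype.card (Row n) - 1) (3 * d)) :
      ∃ R : ℝ, ∀ (t : ℝ) (ht : 0 < t) (C : Domain d n hn l a) (f : C.V ≃ Fin _),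
        C.combType f = τ → C.piTilde = (p, M4.A t ht) → C.IsTrivalent → C.mult ≠ 0 →
          ¬ C.FirstTwoAdjacent → (∀ v w, C.graph.Adj v w → C.dir v w ≠ 0) → t ≤ R := by
    by_contra! hunbounded
    obtain ⟨t, ht, C, f, hf, hpi, hC, hmult, hadj, hcontracted, -⟩ := hunbounded 0
    obtain ⟨R, hR⟩ := exists_bound_of_sameType hC hmult hadj hcontracted hpi
    obtain ⟨t', ht', C', f', hf', hpi', -, -, -, -, hlt⟩ := hunbounded R
    exact hlt.not_ge (hR t' ht' C' (nonempty_sameType (hf.trans hf'.symm)) hpi')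
  choose R hR using hbound
  obtain ⟨M, hM⟩ := Finite.exists_le R
  exact ⟨M, fun t ht C hpi hC hmult hadj hcontracted =>
    (hR _ t ht C (Fintype.equivFinOfCardEq (card_vertices hmult)) rfl hpi hC hmult hadj
      hcontracted).trans (hM _)⟩

end Domain

end PlaneTropical

theorem mainTheorem6 (d l : ℕ) (hd : 2 ≤ d) (hl : 1 ≤ l) (a : ℕ × ℕ → ℝ)
    (p : PlaneTropical.PointMarking (3 * d) → Fin 2 → ℝ) :
    ∃ R : ℝ, ∀ (t : ℝ) (ht : 0 < t), R < t →
      ∀ C : PlaneTropical.Domain d (3 * d) (by omega) l a,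
        C.piTilde = (p, PlaneTropical.M4.A t ht) → C.IsGeneral → C.mult ≠ 0 →
          C.FirstTwoAdjacent ∨ C.DecomposesUniquely := by
  obtain ⟨R, hR⟩ := PlaneTropical.Domain.exists_bound_of_forall_dir_ne_zero d l (by omega) a p
  refine ⟨R, fun t ht hlt C hpi hgeneral hmult => or_iff_not_imp_left.mpr fun hadj => ?_⟩
  by_contra hdec
  refine hlt.not_ge (hR t ht C hpi hgeneral.1 hmult hadj fun v w hvw hdir => hdec ?_)
  exact PlaneTropical.Domain.decomposesUniquely hgeneral.1 hmult
    (PlaneTropical.Domain.exists_separatesFirstTwo (congrArg Prod.snd hpi)) hadj ⟨v, w, hvw, hdir⟩
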